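/- Let $n\ge 1$ and let $M$ be a nonempty smooth (Hausdorff) manifold of dimension $2n+1$, without boundary. A weak almost contact metric structure $(f,Q,\xi,\eta,g)$ on $M$ consists of a smooth $(1,1)$-tensor $f$ of rank $2n$, a smooth nonsingular $(1,1)$-tensor $Q$, a smooth vector field $\xi$, a smooth $1$-form $\eta$ and a Riemannian metric $g$ such that $$f^2=-Q+\eta\otimes\xi,\qquad \eta(\xi)=1,\qquad Q\xi=\xi,\qquad g(fX,fY)=g(X,QY)-\eta(X)\eta(Y)$$ for all vector fields $X,Y$, and such that the distribution $\ker\eta$ is $f$-invariant. Let $\nabla$ be the Levi-Civita connection of $g$ and $R_{X,Y}Z=\nabla_X\nabla_YZ-\nabla_Y\nabla_XZ-\nabla_{[X,Y]}Z$. The structure is weak $\beta$-Kenmotsu, for a real constant $\beta\neq 0$, if $$(\nabla_Xf)Y=\beta\{g(fX,Y)\,\xi-\eta(Y)\,fX\}\qquad\text{for all vector fields }X,Y.$$ The $\ast$-Ricci tensor is $\operatorname{Ric}^\ast(X,Y)=\tfrac12\operatorname{trace}\{Z\mapsto R_{X,fY}fZ\}$. For a smooth vector field $V$ and constants $\lambda,\mu\in\mathbb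 R$, the $\ast$-$\eta$-Ricci soliton equation is $\tfrac12\pounds_Vg+\operatorname{Ric}^\ast=\lambda g+\mu\,\eta\otimes\eta$; a $\ast$-Ricci soliton is the case $\mu=0$, that is, $\tfrac12\pounds_Vg+\operatorname{Ric}^\ast=\lambda g$. If a weak $\beta$-Kenmotsu manifold $M$ ($\beta\ne0$ constant) is a $\ast$-Ricci soliton with some smooth potential vector field $V$ and soliton constant $\lambda$, then $\lambda=0$. -/

import Mathlib

open Bundle VectorField
open scoped Manifold ContDiff

noncomputable section

set_option linter.unusedSectionVars false
set_option linter.unusedSimpArgs false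

namespace WeakKenmotsu

section LeviCivita

variable {E : Type*} [NormedAddCommGroup E] [NormedSpace ℝ E] [FiniteDimensional ℝ E]
  {H : Type*} [TopologicalSpace H] {I : ModelWithCorners ℝ E H}
  {M : Type*} [TopologicalSpace M] [ChartedSpace H M] [IsManifold I ∞ M]

/-- The function `g(X, Y)`. -/
def pairing (g : ContMDiffRiemannianMetric I ∞ E (fun x : M => TangentSpace I x))
    (X Y : Π x : M, TangentSpace I x) : M → ℝ :=
  fun x => g.inner x (X x) (Y x)

/-- The right-hand side of the Koszul formula for `2 g(∇_X Y, Z)`. -/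
def koszul (g : ContMDiffRiemannianMetric I ∞ E (fun x : M => TangentSpace I x))
    (X Y Z : Π x : M, TangentSpace I x) (x : M) : ℝ :=
  mvfderiv I (pairing g Y Z) x (X x) + mvfderiv I (pairing g X Z) x (Y x)
    - mvfderiv I (pairing g X Y) x (Z x)
    + g.inner x (mlieBracket I X Y x) (Z x) - g.inner x (mlieBracket I X Z x) (Y x)
    - g.inner x (mlieBracket I Y Z x) (X x)

variable (g : ContMDiffRiemannianMetric I ∞ E (fun x : M => TangentSpace I x))
  {X X' Y Y' Z Z' : Π x : M, TangentSpace I x} {x : M}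

theorem pairing_comm (X Y : Π x : M, TangentSpace I x) : pairing g X Y = pairing g Y X := by
  funext x; exact g.symm x _ _

theorem mdiff_pairing (hX : MDiffAt (T% X) x) (hY : MDiffAt (T% Y) x) :
    MDiffAt (pairing g X Y) x := by
  have h : MDifferentiableAt I (I.prod 𝓘(ℝ, ℝ))
      (fun m ↦ TotalSpace.mk' ℝ (E := Bundle.Trivial M ℝ) m (g.inner m (X m) (Y m))) x := by
    apply MDifferentiableAt.clm_bundle_apply₂ (F₁ := E) (F₂ := E)
    · exact g.contMDiff.mdifferentiableAt (by simp)
    · exact hX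
    · exact hY
  simp only [mdifferentiableAt_totalSpace] at h
  exact h.2

theorem pairing_smul_right (f : M → ℝ) (X Y : Π x : M, TangentSpace I x) :
    pairing g X (f • Y) = f * pairing g X Y := by
  funext x; simp [pairing]

theorem pairing_smul_left (f : M → ℝ) (X Y : Π x : M, TangentSpace I x) :
    pairing g (f • X) Y = f * pairing g X Y := by
  funext x; simp [pairing]

theorem pairing_add_right (X Y Y' : Π x : M, TangentSpace I x) :
    pairing g X (Y + Y') = pairing g X Y + pairing g X Y' := by
  funext x; simp [pairing]

theorem pairing_add_left (X X' Y : Π x : M, TangentSpace I x) :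
    pairing g (X + X') Y = pairing g X Y + pairing g X' Y := by
  funext x; simp [pairing]

theorem koszul_add_left (hX : MDiffAt (T% X) x) (hX' : MDiffAt (T% X') x)
    (hY : MDiffAt (T% Y) x) (hZ : MDiffAt (T% Z) x) :
    koszul g (X + X') Y Z x = koszul g X Y Z x + koszul g X' Y Z x := by
  simp only [koszul, pairing_add_left, mlieBracket_add_left hX hX',
    mvfderiv_add (mdiff_pairing g hX hZ) (mdiff_pairing g hX' hZ),
    mvfderiv_add (mdiff_pairing g hX hY) (mdiff_pairing g hX' hY), Pi.add_apply,
    map_add, add_apply]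
  ring

theorem koszul_add_middle (hX : MDiffAt (T% X) x) (hY : MDiffAt (T% Y) x)
    (hY' : MDiffAt (T% Y') x) (hZ : MDiffAt (T% Z) x) :
    koszul g X (Y + Y') Z x = koszul g X Y Z x + koszul g X Y' Z x := by
  simp only [koszul, pairing_add_left, pairing_add_right, mlieBracket_add_left hY hY',
    mlieBracket_add_right hY hY',
    mvfderiv_add (mdiff_pairing g hY hZ) (mdiff_pairing g hY' hZ),
    mvfderiv_add (mdiff_pairing g hX hY) (mdiff_pairing g hX hY'), Pi.add_apply,
    map_add, add_apply]
  ring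

theorem koszul_add_right (hX : MDiffAt (T% X) x) (hY : MDiffAt (T% Y) x)
    (hZ : MDiffAt (T% Z) x) (hZ' : MDiffAt (T% Z') x) :
    koszul g X Y (Z + Z') x = koszul g X Y Z x + koszul g X Y Z' x := by
  simp only [koszul, pairing_add_right, mlieBracket_add_right hZ hZ',
    mvfderiv_add (mdiff_pairing g hY hZ) (mdiff_pairing g hY hZ'),
    mvfderiv_add (mdiff_pairing g hX hZ) (mdiff_pairing g hX hZ'), Pi.add_apply,
    map_add, add_apply]
  ring

theorem koszul_smul_left {f : M → ℝ} (hf : MDiffAt f x) (hX : MDiffAt (T% X) x)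
    (hY : MDiffAt (T% Y) x) (hZ : MDiffAt (T% Z) x) :
    koszul g (f • X) Y Z x = f x * koszul g X Y Z x := by
  simp only [koszul, pairing_smul_left, mlieBracket_smul_left hf hX,
    mvfderiv_mul hf (mdiff_pairing g hX hZ),
    mvfderiv_mul hf (mdiff_pairing g hX hY), Pi.smul_apply', map_smul, map_add,
    add_apply, smul_apply, smul_eq_mul, neg_smul, map_neg,
    neg_apply]
  simp only [pairing, g.symm x (X x)]
  ring

theorem koszul_smul_middle {f : M → ℝ} (hf : MDiffAt f x) (hX : MDiffAt (T% X) x)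
    (hY : MDiffAt (T% Y) x) (hZ : MDiffAt (T% Z) x) :
    koszul g X (f • Y) Z x = f x * koszul g X Y Z x
      + 2 * (mvfderiv I f x (X x) * g.inner x (Y x) (Z x)) := by
  simp only [koszul, pairing_smul_left, pairing_smul_right, mlieBracket_smul_left hf hY,
    mlieBracket_smul_right hf hY,
    mvfderiv_mul hf (mdiff_pairing g hY hZ),
    mvfderiv_mul hf (mdiff_pairing g hX hY), Pi.smul_apply', map_smul, map_add,
    add_apply, smul_apply, smul_eq_mul, neg_smul, map_neg,
    neg_apply]
  simp only [pairing, g.symm x (X x) (Y x)]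
  ring

theorem koszul_smul_right {f : M → ℝ} (hf : MDiffAt f x) (hX : MDiffAt (T% X) x)
    (hY : MDiffAt (T% Y) x) (hZ : MDiffAt (T% Z) x) :
    koszul g X Y (f • Z) x = f x * koszul g X Y Z x := by
  simp only [koszul, pairing_smul_right, mlieBracket_smul_right hf hZ,
    mvfderiv_mul hf (mdiff_pairing g hY hZ),
    mvfderiv_mul hf (mdiff_pairing g hX hZ), Pi.smul_apply', map_smul, map_add,
    add_apply, smul_apply, smul_eq_mul, neg_smul, map_neg,
    neg_apply]
  simp only [pairing, g.symm x (Z x)]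
  ring

/-- The Koszul expression as a bilinear form in the values of `X` and `Z`. -/
def koszulForm (Y : Π x : M, TangentSpace I x) (x : M) (hY : MDiffAt (T% Y) x) :
    TangentSpace I x →L[ℝ] TangentSpace I x →L[ℝ] ℝ :=
  TensorialAt.mkHom₂ (I := I) (F := E) (F' := E) (fun X Z => koszul g X Y Z x) x
    (fun _ hZ => ⟨fun hf hX => koszul_smul_left g hf hX hY hZ,
      fun hX hX' => koszul_add_left g hX hX' hY hZ⟩)
    (fun _ hX => ⟨fun hf hZ => koszul_smul_right g hf hX hY hZ,
      fun hZ hZ' => koszul_add_right g hX hY hZ hZ'⟩)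

theorem koszulForm_apply (hX : MDiffAt (T% X) x) (hY : MDiffAt (T% Y) x)
    (hZ : MDiffAt (T% Z) x) : koszulForm g Y x hY (X x) (Z x) = koszul g X Y Z x :=
  TensorialAt.mkHom₂_apply _ _ hX hZ

theorem metric_injective (x : M) : Function.Injective (g.inner x) := by
  refine (injective_iff_map_eq_zero _).2 fun v hv => ?_
  by_contra h
  have := g.pos x v h
  simp [hv] at this

/-- The musical isomorphism `v ↦ g(v, ·)`. -/
def flat (x : M) : TangentSpace I x ≃ₗ[ℝ] (TangentSpace I x →L[ℝ] ℝ) :=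
  haveI : FiniteDimensional ℝ (TangentSpace I x) := inferInstanceAs (FiniteDimensional ℝ E)
  haveI : T2Space (TangentSpace I x) := inferInstanceAs (T2Space E)
  LinearEquiv.ofInjectiveOfFinrankEq (g.inner x).toLinearMap (metric_injective g x)
    ((Subspace.dual_finrank_eq (K := ℝ) (V := TangentSpace I x)).symm.trans
      (LinearMap.toContinuousLinearMap (𝕜 := ℝ) (E := TangentSpace I x) (F' := ℝ)).finrank_eq)

theorem flat_apply (x : M) (v : TangentSpace I x) : flat g x v = g.inner x v := by
  have : FiniteDimensional ℝ (TangentSpace I x) := inferInstanceAs (FiniteDimensional ℝ E)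
  have : T2Space (TangentSpace I x) := inferInstanceAs (T2Space E)
  exact LinearMap.congr_fun (LinearEquiv.coe_ofInjectiveOfFinrankEq _ _ _) v

/-- The metric dual of a linear form. -/
def sharp (x : M) : (TangentSpace I x →L[ℝ] ℝ) →L[ℝ] TangentSpace I x :=
  haveI : FiniteDimensional ℝ (TangentSpace I x) := inferInstanceAs (FiniteDimensional ℝ E)
  haveI : T2Space (TangentSpace I x) := inferInstanceAs (T2Space E)
  LinearMap.toContinuousLinearMap (flat g x).symm.toLinearMap

theorem inner_sharp (x : M) (a : TangentSpace I x →L[ℝ] ℝ) (v : TangentSpace I x) :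
    g.inner x (sharp g x a) v = a v := by
  rw [← flat_apply]
  exact congrArg (fun b : TangentSpace I x →L[ℝ] ℝ => b v) ((flat g x).apply_symm_apply a)

open Classical in
/-- The operator `Y ↦ ∇Y` given by the Koszul formula (zero where `Y` is not differentiable). -/
def leviCivitaFun (Y : Π x : M, TangentSpace I x) (x : M) :
    TangentSpace I x →L[ℝ] TangentSpace I x :=
  if hY : MDiffAt (T% Y) x then (sharp g x).comp ((1 / 2 : ℝ) • koszulForm g Y x hY) else 0

theorem inner_leviCivitaFun (hX : MDiffAt (T% X) x) (hY : MDiffAt (T% Y) x)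
    (hZ : MDiffAt (T% Z) x) :
    g.inner x (leviCivitaFun g Y x (X x)) (Z x) = 1 / 2 * koszul g X Y Z x := by
  rw [leviCivitaFun, dif_pos hY, ContinuousLinearMap.comp_apply, inner_sharp,
    ← koszulForm_apply g hX hY hZ]
  rfl

theorem inner_ext {v w : TangentSpace I x}
    (h : ∀ Z : Π x : M, TangentSpace I x, MDiffAt (T% Z) x →
      g.inner x v (Z x) = g.inner x w (Z x)) : v = w := by
  apply metric_injective g x
  ext z
  simpa using h (FiberBundle.extend E z) (FiberBundle.mdifferentiableAt_extend I E z)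

theorem clm_ext {A B : TangentSpace I x →L[ℝ] TangentSpace I x}
    (h : ∀ X : Π x : M, TangentSpace I x, MDiffAt (T% X) x → A (X x) = B (X x)) : A = B := by
  ext1 v
  simpa using h (FiberBundle.extend E v) (FiberBundle.mdifferentiableAt_extend I E v)

/-- The Levi-Civita connection of `g`; `leviCivita g Y x v` is `∇_v Y` for `v` tangent at `x`. -/
def leviCivita : CovariantDerivative I E (fun x : M => TangentSpace I x) where
  toFun := leviCivitaFun g
  isCovariantDerivativeOnUniv :=
    { add := by
        intro Y Y' x hY hY' _
        refine clm_ext (fun X hX => inner_ext g (fun Z hZ => ?_))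
        have hs : MDiffAt (T% (Y + Y')) x := mdifferentiableAt_add_section hY hY'
        simp only [add_apply, map_add]
        rw [inner_leviCivitaFun g hX hs hZ, inner_leviCivitaFun g hX hY hZ,
          inner_leviCivitaFun g hX hY' hZ, koszul_add_middle g hX hY hY' hZ]
        ring
      leibniz := by
        intro Y f x hY hf _
        refine clm_ext (fun X hX => inner_ext g (fun Z hZ => ?_))
        have hs : MDiffAt (T% (f • Y)) x := hf.smul_section hY
        simp only [add_apply, map_add, smul_apply, map_smul, ContinuousLinearMap.smulRight_apply]
        rw [inner_leviCivitaFun g hX hs hZ, inner_leviCivitaFun g hX hY hZ,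
          koszul_smul_middle g hf hX hY hZ]
        simp only [smul_eq_mul]
        ring }

theorem inner_leviCivita (hX : MDiffAt (T% X) x) (hY : MDiffAt (T% Y) x)
    (hZ : MDiffAt (T% Z) x) :
    g.inner x (leviCivita g Y x (X x)) (Z x) = 1 / 2 * koszul g X Y Z x :=
  inner_leviCivitaFun g hX hY hZ

/-- The Levi-Civita connection is torsion-free. -/
theorem leviCivita_torsion (hX : MDiffAt (T% X) x) (hY : MDiffAt (T% Y) x) :
    leviCivita g Y x (X x) - leviCivita g X x (Y x) = mlieBracket I X Y x := by
  refine inner_ext g (fun Z hZ => ?_)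
  simp only [map_sub, sub_apply]
  rw [inner_leviCivita g hX hY hZ, inner_leviCivita g hY hX hZ]
  simp only [koszul, pairing_comm g Y X, mlieBracket_swap_apply (V := Y) (W := X), map_neg,
    neg_apply]
  ring

/-- The Levi-Civita connection is metric. -/
theorem leviCivita_metric (hX : MDiffAt (T% X) x) (hY : MDiffAt (T% Y) x)
    (hZ : MDiffAt (T% Z) x) :
    mvfderiv I (pairing g Y Z) x (X x)
      = g.inner x (leviCivita g Y x (X x)) (Z x) + g.inner x (Y x) (leviCivita g Z x (X x)) := by
  rw [g.symm x (Y x), inner_leviCivita g hX hY hZ, inner_leviCivita g hX hZ hY]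
  simp only [koszul, pairing_comm g Z Y, mlieBracket_swap_apply (V := Z) (W := Y), map_neg,
    neg_apply]
  ring

/-- The curvature field `R_{X,Y} Z = ∇_X ∇_Y Z - ∇_Y ∇_X Z - ∇_{[X,Y]} Z`. -/
def curvatureField (X Y Z : Π x : M, TangentSpace I x) (x : M) : TangentSpace I x :=
  leviCivita g (fun y => leviCivita g Z y (Y y)) x (X x)
    - leviCivita g (fun y => leviCivita g Z y (X y)) x (Y x)
    - leviCivita g Z x (mlieBracket I X Y x)

/-- The curvature tensor `R_{u,v} w` at a point: the curvature field is evaluated on vector fields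
that are smooth near `x` and take the values `u`, `v`, `w` there. -/
def curvatureAt (x : M) (u v w : TangentSpace I x) : TangentSpace I x :=
  curvatureField g (FiberBundle.extend E u) (FiberBundle.extend E v) (FiberBundle.extend E w) x

/-- The `∗`-Ricci tensor `Ric^∗(u, v) = (1/2) trace {w ↦ R_{u, f v} (f w)}`; the trace is written
out in a basis of the tangent space. -/
def starRicci (f : Π x : M, TangentSpace I x →L[ℝ] TangentSpace I x) (x : M)
    (u v : TangentSpace I x) : ℝ :=
  haveI : FiniteDimensional ℝ (TangentSpace I x) := inferInstanceAs (FiniteDimensional ℝ E)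
  1 / 2 * ∑ i, (Module.finBasis ℝ (TangentSpace I x)).repr
    (curvatureAt g x u (f x v) (f x (Module.finBasis ℝ (TangentSpace I x) i))) i

/-- The Lie derivative `(£_V g)(X, Y) = V (g(X, Y)) - g([V, X], Y) - g(X, [V, Y])`. -/
def lieDerivMetric (V X Y : Π x : M, TangentSpace I x) (x : M) : ℝ :=
  mvfderiv I (pairing g X Y) x (V x) - g.inner x (mlieBracket I V X x) (Y x)
    - g.inner x (X x) (mlieBracket I V Y x)

/-- Smooth vector fields on `M`. -/
def IsSmoothField (X : Π x : M, TangentSpace I x) : Prop :=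
  ContMDiff I (I.prod 𝓘(ℝ, E)) ∞ (fun x => TotalSpace.mk' E x (X x))

/-- Smooth `(1,1)`-tensor fields on `M`. -/
def IsSmoothEndo (f : Π x : M, TangentSpace I x →L[ℝ] TangentSpace I x) : Prop :=
  ContMDiff I (I.prod 𝓘(ℝ, E →L[ℝ] E)) ∞
    (fun x => TotalSpace.mk' (E →L[ℝ] E)
      (E := fun x : M => TangentSpace I x →L[ℝ] TangentSpace I x) x (f x))

/-- Smooth `1`-forms on `M`. -/
def IsSmoothForm (η : Π x : M, TangentSpace I x →L[ℝ] ℝ) : Prop :=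
  ContMDiff I (I.prod 𝓘(ℝ, E →L[ℝ] ℝ)) ∞
    (fun x => TotalSpace.mk' (E →L[ℝ] ℝ)
      (E := fun x : M => TangentSpace I x →L[ℝ] Bundle.Trivial M ℝ x) x (η x))

end LeviCivita

section Structures

/-- A weak almost contact metric structure `(f, Q, ξ, η, g)` on a smooth manifold of dimension
`2 n + 1`, with `f`-invariant distribution `ker η`. -/
structure WeakAlmostContactMetric (n : ℕ) (M : Type*) [TopologicalSpace M]
    [ChartedSpace (EuclideanSpace ℝ (Fin (2 * n + 1))) M]
    [IsManifold (𝓡 (2 * n + 1)) ∞ M] where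
  f : Π x : M, TangentSpace (𝓡 (2 * n + 1)) x →L[ℝ] TangentSpace (𝓡 (2 * n + 1)) x
  Q : Π x : M, TangentSpace (𝓡 (2 * n + 1)) x →L[ℝ] TangentSpace (𝓡 (2 * n + 1)) x
  ξ : Π x : M, TangentSpace (𝓡 (2 * n + 1)) x
  η : Π x : M, TangentSpace (𝓡 (2 * n + 1)) x →L[ℝ] ℝ
  g : ContMDiffRiemannianMetric (𝓡 (2 * n + 1)) ∞ (EuclideanSpace ℝ (Fin (2 * n + 1)))
    (fun x : M => TangentSpace (𝓡 (2 * n + 1)) x)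
  smooth_f : IsSmoothEndo f
  smooth_Q : IsSmoothEndo Q
  smooth_ξ : IsSmoothField ξ
  smooth_η : IsSmoothForm η
  rank_f : ∀ x, Module.finrank ℝ (LinearMap.range (f x).toLinearMap) = 2 * n
  nonsingular_Q : ∀ x, Function.Bijective (Q x)
  f_sq : ∀ x v, f x (f x v) = -Q x v + η x v • ξ x
  η_ξ : ∀ x, η x (ξ x) = 1
  Q_ξ : ∀ x, Q x (ξ x) = ξ x
  compat : ∀ x v w, g.inner x (f x v) (f x w) = g.inner x v (Q x w) - η x v * η x w
  f_invariant : ∀ x v, η x v = 0 → η x (f x v) = 0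

variable {n : ℕ} {M : Type*} [TopologicalSpace M]
  [ChartedSpace (EuclideanSpace ℝ (Fin (2 * n + 1))) M] [IsManifold (𝓡 (2 * n + 1)) ∞ M]

/-- The structure is weak `β`-Kenmotsu, for a nonzero constant `β`:
`(∇_X f) Y = ∇_X (f Y) - f (∇_X Y) = β (g(f X, Y) ξ - η(Y) f X)` for all vector fields `X`, `Y`. -/
structure IsWeakKenmotsu (S : WeakAlmostContactMetric n M) (β : ℝ) : Prop where
  ne_zero : β ≠ 0
  nabla_f : ∀ X Y : Π x : M, TangentSpace (𝓡 (2 * n + 1)) x,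
    IsSmoothField X → IsSmoothField Y → ∀ x,
      leviCivita S.g (fun y => S.f y (Y y)) x (X x) - S.f x (leviCivita S.g Y x (X x))
        = β • (S.g.inner x (S.f x (X x)) (Y x) • S.ξ x - S.η x (Y x) • S.f x (X x))

/-- The `∗`-`η`-Ricci soliton equation `(1/2) £_V g + Ric^∗ = lam g + mu η ⊗ η` with a smooth
potential vector field `V` and constants `lam`, `mu`. -/
structure IsStarEtaRicciSoliton (S : WeakAlmostContactMetric n M)
    (V : Π x : M, TangentSpace (𝓡 (2 * n + 1)) x) (lam mu : ℝ) : Prop where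
  smooth_V : IsSmoothField V
  equation : ∀ X Y : Π x : M, TangentSpace (𝓡 (2 * n + 1)) x,
    IsSmoothField X → IsSmoothField Y → ∀ x,
      1 / 2 * lieDerivMetric S.g V X Y x + starRicci S.g S.f x (X x) (Y x)
        = lam * S.g.inner x (X x) (Y x) + mu * (S.η x (X x) * S.η x (Y x))

/-- A `∗`-Ricci soliton is a `∗`-`η`-Ricci soliton with `mu = 0`. -/
def IsStarRicciSoliton (S : WeakAlmostContactMetric n M)
    (V : Π x : M, TangentSpace (𝓡 (2 * n + 1)) x) (lam : ℝ) : Prop :=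
  IsStarEtaRicciSoliton S V lam 0

end Structures

end WeakKenmotsu

end

noncomputable section

set_option linter.unusedSectionVars false

namespace WeakKenmotsu

/-- The algebraic structure carried by the vector fields of a Riemannian manifold over its smooth
functions: directional derivative, Lie bracket, metric and Levi-Civita connection. -/
structure RiemannianLieRinehart (C 𝔛 : Type*) [CommRing C] [AddCommGroup 𝔛] [Module C 𝔛] where
  D : 𝔛 → C → C
  brk : 𝔛 → 𝔛 → 𝔛
  g : 𝔛 → 𝔛 → C
  nab : 𝔛 → 𝔛 → 𝔛
  D_add : ∀ X a b, D X (a + b) = D X a + D X b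
  D_mul : ∀ X a b, D X (a * b) = D X a * b + a * D X b
  D_smul_left : ∀ (a : C) (X : 𝔛) (b : C), D (a • X) b = a * D X b
  D_add_left : ∀ X Y b, D (X + Y) b = D X b + D Y b
  brk_skew : ∀ X Y, brk X Y = -brk Y X
  brk_add : ∀ X Y Z, brk X (Y + Z) = brk X Y + brk X Z
  brk_smul : ∀ (X : 𝔛) (a : C) (Y : 𝔛), brk X (a • Y) = D X a • Y + a • brk X Y
  jacobi : ∀ X Y Z, brk X (brk Y Z) = brk (brk X Y) Z + brk Y (brk X Z)
  g_symm : ∀ X Y, g X Y = g Y X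
  g_add : ∀ X Y Z, g X (Y + Z) = g X Y + g X Z
  g_smul : ∀ (X : 𝔛) (a : C) (Y : 𝔛), g X (a • Y) = a * g X Y
  g_ext : ∀ X Y, (∀ Z, g X Z = g Y Z) → X = Y
  nab_add_left : ∀ X Y Z, nab (X + Y) Z = nab X Z + nab Y Z
  nab_smul_left : ∀ (a : C) (X Y : 𝔛), nab (a • X) Y = a • nab X Y
  nab_add : ∀ X Y Z, nab X (Y + Z) = nab X Y + nab X Z
  nab_smul : ∀ (X : 𝔛) (a : C) (Y : 𝔛), nab X (a • Y) = D X a • Y + a • nab X Y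
  torsion : ∀ X Y, nab X Y - nab Y X = brk X Y
  metric : ∀ X Y Z, D X (g Y Z) = g (nab X Y) Z + g Y (nab X Z)
  two_torsion : ∀ a : C, a + a = 0 → a = 0

namespace RiemannianLieRinehart

variable {C 𝔛 : Type*} [CommRing C] [AddCommGroup 𝔛] [Module C 𝔛]
  (A : RiemannianLieRinehart C 𝔛)

theorem D_zero (X : 𝔛) : A.D X 0 = 0 := by
  have := A.D_add X 0 0
  simpa using this

theorem D_one (X : 𝔛) : A.D X 1 = 0 := by
  have := A.D_mul X 1 1
  simpa using this

theorem D_neg (X : 𝔛) (a : C) : A.D X (-a) = -A.D X a := by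
  have := A.D_add X a (-a)
  rw [add_neg_cancel, A.D_zero] at this
  linear_combination -this

theorem D_sub (X : 𝔛) (a b : C) : A.D X (a - b) = A.D X a - A.D X b := by
  rw [sub_eq_add_neg, A.D_add, A.D_neg]; ring

theorem D_natCast (X : 𝔛) (n : ℕ) : A.D X (n : C) = 0 := by
  induction n with
  | zero => simp [A.D_zero]
  | succ n ih => simp [A.D_add, A.D_one, ih]

theorem D_ofNat (X : 𝔛) (n : ℕ) [n.AtLeastTwo] : A.D X (ofNat(n) : C) = 0 :=
  A.D_natCast X n

theorem D_neg_left (X : 𝔛) (a : C) : A.D (-X) a = -A.D X a := by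
  have := A.D_smul_left (-1) X a
  simpa using this

theorem D_sub_left (X Y : 𝔛) (a : C) : A.D (X - Y) a = A.D X a - A.D Y a := by
  rw [sub_eq_add_neg, A.D_add_left, A.D_neg_left]; ring

theorem D_sum {ι : Type*} (s : Finset ι) (X : 𝔛) (a : ι → C) :
    A.D X (∑ i ∈ s, a i) = ∑ i ∈ s, A.D X (a i) :=
  map_sum (⟨⟨A.D X, A.D_zero X⟩, A.D_add X⟩ : C →+ C) a s

theorem g_zero (X : 𝔛) : A.g X 0 = 0 := by simpa using A.g_smul X 0 0

theorem g_neg (X Y : 𝔛) : A.g X (-Y) = -A.g X Y := by simpa using A.g_smul X (-1) Y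

theorem g_sub (X Y Z : 𝔛) : A.g X (Y - Z) = A.g X Y - A.g X Z := by
  rw [sub_eq_add_neg, A.g_add, A.g_neg]; ring

theorem g_add_left (X Y Z : 𝔛) : A.g (X + Y) Z = A.g X Z + A.g Y Z := by
  rw [A.g_symm, A.g_add, A.g_symm Z, A.g_symm Z]

theorem g_smul_left (a : C) (X Z : 𝔛) : A.g (a • X) Z = a * A.g X Z := by
  rw [A.g_symm, A.g_smul, A.g_symm Z]

theorem g_neg_left (X Z : 𝔛) : A.g (-X) Z = -A.g X Z := by
  rw [A.g_symm, A.g_neg, A.g_symm Z]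

theorem g_sub_left (X Y Z : 𝔛) : A.g (X - Y) Z = A.g X Z - A.g Y Z := by
  rw [A.g_symm, A.g_sub, A.g_symm Z, A.g_symm Z]

theorem g_zero_left (Z : 𝔛) : A.g 0 Z = 0 := by rw [A.g_symm, A.g_zero]

theorem brk_neg (X Y : 𝔛) : A.brk X (-Y) = -A.brk X Y := by
  have h : A.D X (-1) = 0 := by rw [A.D_neg, A.D_one, neg_zero]
  simpa [h] using A.brk_smul X (-1) Y

theorem brk_sub (X Y Z : 𝔛) : A.brk X (Y - Z) = A.brk X Y - A.brk X Z := by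
  rw [sub_eq_add_neg, A.brk_add, A.brk_neg, sub_eq_add_neg]

theorem brk_add_left (X Y Z : 𝔛) : A.brk (X + Y) Z = A.brk X Z + A.brk Y Z := by
  rw [A.brk_skew, A.brk_add, A.brk_skew X, A.brk_skew Y]; abel

theorem brk_neg_left (X Z : 𝔛) : A.brk (-X) Z = -A.brk X Z := by
  rw [A.brk_skew, A.brk_neg, A.brk_skew X]

theorem brk_sub_left (X Y Z : 𝔛) : A.brk (X - Y) Z = A.brk X Z - A.brk Y Z := by
  rw [sub_eq_add_neg, A.brk_add_left, A.brk_neg_left, sub_eq_add_neg]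

theorem brk_smul_left (a : C) (X Z : 𝔛) :
    A.brk (a • X) Z = -(A.D Z a • X) + a • A.brk X Z := by
  rw [A.brk_skew, A.brk_smul, A.brk_skew X, smul_neg, neg_add]

theorem brk_sum {ι : Type*} (s : Finset ι) (X : 𝔛) (Y : ι → 𝔛) :
    A.brk X (∑ i ∈ s, Y i) = ∑ i ∈ s, A.brk X (Y i) :=
  map_sum (⟨⟨A.brk X, by simpa [A.D_zero] using A.brk_smul X 0 0⟩, A.brk_add X⟩ : 𝔛 →+ 𝔛) Y s

theorem nab_neg (X Y : 𝔛) : A.nab X (-Y) = -A.nab X Y := by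
  have h : A.D X (-1) = 0 := by rw [A.D_neg, A.D_one, neg_zero]
  simpa [h] using A.nab_smul X (-1) Y

theorem nab_sub (X Y Z : 𝔛) : A.nab X (Y - Z) = A.nab X Y - A.nab X Z := by
  rw [sub_eq_add_neg, A.nab_add, A.nab_neg, sub_eq_add_neg]

theorem nab_neg_left (X Z : 𝔛) : A.nab (-X) Z = -A.nab X Z := by
  simpa using A.nab_smul_left (-1) X Z

/-- In the presence of a unit field, the bracket acts on functions as a commutator. -/
theorem D_brk {W : 𝔛} (hW : A.g W W = 1) (X Y : 𝔛) (a : C) :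
    A.D (A.brk X Y) a = A.D X (A.D Y a) - A.D Y (A.D X a) := by
  have h := congrArg (A.g W) (A.jacobi X Y (a • W))
  simp only [A.brk_smul, A.brk_add, A.g_add, A.g_smul, hW] at h
  have h' := congrArg (A.g W) (A.jacobi X Y W)
  simp only [A.g_add] at h'
  linear_combination -h + a * h'

/-- The Lie derivative along `W` of a `C`-valued function of two fields. -/
def lie (W : 𝔛) (T : 𝔛 → 𝔛 → C) (X Y : 𝔛) : C :=
  A.D W (T X Y) - T (A.brk W X) Y - T X (A.brk W Y)

/-- The curvature `R_{X,Y} Z`. -/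
def curv (X Y Z : 𝔛) : 𝔛 :=
  A.nab X (A.nab Y Z) - A.nab Y (A.nab X Z) - A.nab (A.brk X Y) Z

theorem curv_add_left (X X' Y Z : 𝔛) :
    A.curv (X + X') Y Z = A.curv X Y Z + A.curv X' Y Z := by
  simp only [curv, A.nab_add_left, A.nab_add, A.brk_add_left]; abel

theorem curv_add_middle (X Y Y' Z : 𝔛) :
    A.curv X (Y + Y') Z = A.curv X Y Z + A.curv X Y' Z := by
  simp only [curv, A.nab_add_left, A.nab_add, A.brk_add]; abel

theorem curv_add_right (X Y Z Z' : 𝔛) :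
    A.curv X Y (Z + Z') = A.curv X Y Z + A.curv X Y Z' := by
  simp only [curv, A.nab_add]; abel

theorem curv_smul_left (a : C) (X Y Z : 𝔛) : A.curv (a • X) Y Z = a • A.curv X Y Z := by
  simp only [curv, A.nab_smul_left, A.nab_smul, A.brk_smul_left, A.nab_add_left, A.nab_neg_left]
  module

theorem curv_smul_middle (X : 𝔛) (a : C) (Y Z : 𝔛) :
    A.curv X (a • Y) Z = a • A.curv X Y Z := by
  simp only [curv, A.nab_smul_left, A.nab_smul, A.brk_smul, A.nab_add_left]
  module

theorem curv_smul_right {W : 𝔛} (hW : A.g W W = 1) (X Y : 𝔛) (a : C) (Z : 𝔛) :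
    A.curv X Y (a • Z) = a • A.curv X Y Z := by
  simp only [curv, A.nab_smul, A.nab_add, A.D_brk hW]
  module

/-- A local frame, cut off so as to be globally defined. -/
structure CutoffFrame (C 𝔛 : Type*) [CommRing C] [AddCommGroup 𝔛] [Module C 𝔛]
    (ι : Type*) [Fintype ι] [DecidableEq ι] where
  e : ι → 𝔛
  θ : ι → 𝔛 →ₗ[C] C
  φ : C
  expand : ∀ X, φ • X = ∑ i, θ i X • e i
  dual : ∀ i j, θ i (e j) = if i = j then φ else 0

section Trace

variable {ι : Type*} [Fintype ι] [DecidableEq ι] (F : CutoffFrame C 𝔛 ι)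

/-- The trace of an operator with respect to a cut-off frame. -/
def CutoffFrame.tr (T : 𝔛 → 𝔛) : C := ∑ i, F.θ i (T (F.e i))

theorem CutoffFrame.tr_rank_one (α : 𝔛 →ₗ[C] C) (W : 𝔛) :
    F.tr (fun Z => α Z • W) = F.φ * α W := by
  have := congrArg α (F.expand W)
  simp only [map_smul, map_sum, smul_eq_mul] at this
  rw [this]
  simp [CutoffFrame.tr, mul_comm]

/-- The derivative of the trace of an endomorphism field is the trace of its Lie derivative. -/
theorem D_tr (T : 𝔛 →ₗ[C] 𝔛) (W : 𝔛) :
    F.φ * (A.D W (F.tr T) - F.tr (fun Z => A.brk W (T Z) - T (A.brk W Z)))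
      = A.D W F.φ * F.tr T := by
  have h1 (j : ι) := congrArg (F.θ j) (congrArg (A.brk W) (F.expand (T (F.e j))))
  simp only [A.brk_smul, A.brk_sum, map_add, map_sum, map_smul, smul_eq_mul, F.dual,
    Finset.sum_add_distrib, mul_ite, mul_zero, Finset.sum_ite_eq, Finset.mem_univ, if_true] at h1
  have h2 (j : ι) := congrArg (F.θ j) (congrArg T (F.expand (A.brk W (F.e j))))
  simp only [map_sum, map_smul, smul_eq_mul] at h2
  have h1' := Finset.sum_congr (rfl : (Finset.univ : Finset ι) = Finset.univ) fun j _ => h1 j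
  have h2' := Finset.sum_congr (rfl : (Finset.univ : Finset ι) = Finset.univ) fun j _ => h2 j
  simp only [Finset.sum_add_distrib, ← Finset.mul_sum, ← Finset.sum_mul] at h1' h2'
  have h3 : ∑ i, ∑ j, F.θ j (T (F.e i)) * F.θ i (A.brk W (F.e j))
      = ∑ i, ∑ j, F.θ j (A.brk W (F.e i)) * F.θ i (T (F.e j)) := by
    rw [Finset.sum_comm]
    simp only [mul_comm]
  simp only [CutoffFrame.tr, A.D_sum, map_sub, Finset.sum_sub_distrib]
  linear_combination -h1' + h2' - h3

end Trace

/-- The identities of a weak `b`-Kenmotsu structure used for the `∗`-Ricci tensor. -/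
structure KenmotsuData where
  ξ : 𝔛
  b : C
  f : 𝔛 →ₗ[C] 𝔛
  D_b : ∀ X, A.D X b = 0
  g_ξ_ξ : A.g ξ ξ = 1
  nab_ξ : ∀ X, A.nab X ξ = b • (X - A.g ξ X • ξ)
  nab_ξ_f : ∀ Y, A.nab ξ (f Y) = f (A.nab ξ Y)
  f_ξ : f ξ = 0
  g_ξ_f : ∀ Y, A.g ξ (f Y) = 0
  g_f_f : ∀ X Y, A.g X (f (f Y)) = -A.g (f X) (f Y)

namespace KenmotsuData

variable {A} (K : A.KenmotsuData)

/-- The transverse metric `g - η ⊗ η`. -/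
def h (X Y : 𝔛) : C := A.g X Y - A.g K.ξ X * A.g K.ξ Y

/-- The form `g(f ·, f ·)`. -/
def ff (X Y : 𝔛) : C := A.g (K.f X) (K.f Y)

theorem h_symm (X Y : 𝔛) : K.h X Y = K.h Y X := by
  simp only [h, A.g_symm X Y]; ring

theorem brk_ξ (X : 𝔛) : A.brk K.ξ X = A.nab K.ξ X - K.b • (X - A.g K.ξ X • K.ξ) := by
  rw [← A.torsion, K.nab_ξ]

theorem D_η (X Y : 𝔛) : A.D X (A.g K.ξ Y) = K.b * K.h X Y + A.g K.ξ (A.nab X Y) := by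
  rw [A.metric, K.nab_ξ]
  simp only [A.g_smul_left, A.g_sub_left, h]

/-- The form `η` is closed. -/
theorem η_closed (X Y : 𝔛) :
    A.D X (A.g K.ξ Y) - A.D Y (A.g K.ξ X) = A.g K.ξ (A.brk X Y) := by
  rw [K.D_η, K.D_η, ← A.torsion, A.g_sub, K.h_symm]; ring

theorem D_ξ_η (X : 𝔛) : A.D K.ξ (A.g K.ξ X) = A.g K.ξ (A.brk K.ξ X) := by
  have := K.η_closed K.ξ X
  rwa [K.g_ξ_ξ, A.D_one, sub_zero] at this

theorem lie_ξ_g (X Y : 𝔛) : A.lie K.ξ A.g X Y = 2 * K.b * K.h X Y := by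
  simp only [lie, A.metric, brk_ξ, A.g_sub, A.g_sub_left, A.g_smul, A.g_smul_left, h,
    A.g_symm X K.ξ]
  ring

theorem lie_ξ_h (X Y : 𝔛) : A.lie K.ξ K.h X Y = 2 * K.b * K.h X Y := by
  have := K.lie_ξ_g X Y
  simp only [lie, h, A.D_sub, A.D_mul, K.D_ξ_η] at this ⊢
  linear_combination this

theorem brk_ξ_f (X : 𝔛) : A.brk K.ξ (K.f X) = K.f (A.brk K.ξ X) := by
  simp only [brk_ξ, K.nab_ξ_f, K.g_ξ_f, map_sub, map_smul, K.f_ξ]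
  simp

theorem lie_ξ_ff (X Y : 𝔛) : A.lie K.ξ K.ff X Y = 2 * K.b * K.ff X Y := by
  have := K.lie_ξ_g (K.f X) (K.f Y)
  simp only [lie, ff, K.brk_ξ_f, h, K.g_ξ_f] at this ⊢
  linear_combination this

theorem D_h (X Y Z : 𝔛) : A.D X (K.h Y Z) = K.h (A.nab X Y) Z + K.h Y (A.nab X Z)
    - K.b * (K.h X Y * A.g K.ξ Z + A.g K.ξ Y * K.h X Z) := by
  simp only [h, A.D_sub, A.D_mul, K.D_η, A.metric X Y Z]
  ring

/-- The Lie derivative of the Levi-Civita connection along `ξ`, corrected by its value. -/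
def lieNabDefect (X Y : 𝔛) : 𝔛 :=
  A.brk K.ξ (A.nab X Y) - A.nab (A.brk K.ξ X) Y - A.nab X (A.brk K.ξ Y)
    + (2 * K.b * K.b * K.h X Y) • K.ξ

theorem lieNabDefect_symm (X Y : 𝔛) : K.lieNabDefect X Y = K.lieNabDefect Y X := by
  have h1 := A.jacobi K.ξ X Y
  rw [← A.torsion X Y, A.brk_sub, ← A.torsion _ Y, ← A.torsion X (A.brk _ _)] at h1
  rw [← sub_eq_zero] at h1 ⊢
  rw [← h1]
  simp only [lieNabDefect, K.h_symm Y X]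
  abel

theorem lieNabDefect_skew (X Y Z : 𝔛) :
    A.g (K.lieNabDefect X Y) Z = -A.g (K.lieNabDefect X Z) Y := by
  have e1 := K.lie_ξ_g (A.nab X Y) Z
  have e2 := K.lie_ξ_g (A.nab X Z) Y
  have e3 := congrArg (A.D X) (K.lie_ξ_g Y Z)
  have e4 := A.metric (A.brk K.ξ X) Y Z
  have e5 := A.metric X (A.brk K.ξ Y) Z
  have e6 := A.metric X Y (A.brk K.ξ Z)
  have e7 := A.D_brk K.g_ξ_ξ K.ξ X (A.g Y Z)
  have e8 := congrArg (A.D K.ξ) (A.metric X Y Z)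
  rw [A.D_mul, A.D_mul, A.D_ofNat, K.D_b, K.D_h] at e3
  simp only [lie, A.D_sub, A.D_add, h, lieNabDefect, A.g_add_left, A.g_sub_left, A.g_smul_left,
    A.g_symm Y (A.nab _ _), A.g_symm (A.brk K.ξ Y) (A.nab _ _)] at *
  linear_combination -e1 - e2 + e3 + e4 + e5 + e6 - e7 - e8

theorem lie_nab (X Y : 𝔛) : A.brk K.ξ (A.nab X Y)
    = A.nab (A.brk K.ξ X) Y + A.nab X (A.brk K.ξ Y) - (2 * K.b * K.b * K.h X Y) • K.ξ := by
  have h0 : K.lieNabDefect X Y = 0 := by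
    apply A.g_ext
    intro Z
    rw [A.g_zero_left]
    apply A.two_torsion
    have h1 := K.lieNabDefect_skew X Y Z
    have h2 := K.lieNabDefect_skew Z X Y
    have h3 := K.lieNabDefect_skew Y Z X
    rw [K.lieNabDefect_symm X Z] at h1
    rw [K.lieNabDefect_symm Z Y] at h2
    rw [K.lieNabDefect_symm Y X] at h3
    linear_combination h1 - h2 + h3
  rw [← sub_eq_zero, ← h0, lieNabDefect]
  abel

/-- The Lie derivative of the curvature along `ξ`. -/
theorem lie_curv (X Y Z : 𝔛) : A.brk K.ξ (A.curv X Y Z)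
    = A.curv (A.brk K.ξ X) Y Z + A.curv X (A.brk K.ξ Y) Z + A.curv X Y (A.brk K.ξ Z)
      - (2 * K.b ^ 3) • (K.h Y Z • X - K.h X Z • Y) := by
  simp only [curv, A.brk_sub, lie_nab, A.nab_add, A.nab_sub, A.nab_smul, A.jacobi K.ξ X Y,
    A.nab_add_left, K.nab_ξ, A.D_mul, A.D_ofNat, K.D_b, K.D_h]
  have := A.torsion X Y
  rw [← this]
  simp only [h, A.g_sub, A.g_sub_left, A.g_symm Y X]
  module

theorem h_add_left (X X' Y : 𝔛) : K.h (X + X') Y = K.h X Y + K.h X' Y := by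
  simp only [h, A.g_add_left, A.g_add]; ring

theorem h_smul_left (a : C) (X Y : 𝔛) : K.h (a • X) Y = a * K.h X Y := by
  simp only [h, A.g_smul_left, A.g_smul]; ring

theorem h_ξ (X : 𝔛) : K.h X K.ξ = 0 := by
  simp only [h, K.g_ξ_ξ, A.g_symm X]; ring

/-- The linear form `h(·, Y)`. -/
def hForm (Y : 𝔛) : 𝔛 →ₗ[C] C where
  toFun X := K.h X Y
  map_add' X X' := K.h_add_left X X' Y
  map_smul' a X := K.h_smul_left a X Y

/-- The operator `Z ↦ R_{X, f Y} (f Z)`. -/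
def starOp (X Y : 𝔛) : 𝔛 →ₗ[C] 𝔛 where
  toFun Z := A.curv X (K.f Y) (K.f Z)
  map_add' Z Z' := by rw [map_add, A.curv_add_right]
  map_smul' a Z := by rw [map_smul, A.curv_smul_right K.g_ξ_ξ, RingHom.id_apply]

theorem starOp_apply (X Y Z : 𝔛) : K.starOp X Y Z = A.curv X (K.f Y) (K.f Z) := rfl

theorem lie_starOp (X Y Z : 𝔛) : A.brk K.ξ (K.starOp X Y Z) - K.starOp X Y (A.brk K.ξ Z)
    = K.starOp (A.brk K.ξ X) Y Z + K.starOp X (A.brk K.ξ Y) Z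
      - (2 * K.b ^ 3) • (K.hForm (K.f Y) (K.f Z) • X - K.hForm X (K.f Z) • K.f Y) := by
  simp only [starOp_apply, K.lie_curv, K.brk_ξ_f, hForm, LinearMap.coe_mk, AddHom.coe_mk,
    K.h_symm (K.f Z)]
  abel

/-- A form whose localizations are the traces of `Z ↦ R_{X, f Y} (f Z)` satisfies
`£_ξ Ric^∗ = -2 b³ g(f ·, f ·)`; here `r` stands for `2 Ric^∗`. -/
theorem lie_trace {ι : Type*} [Fintype ι] [DecidableEq ι] (F : CutoffFrame C 𝔛 ι)
    (r : 𝔛 → 𝔛 → C) (hr : ∀ X Y, F.φ * r X Y = F.tr (K.starOp X Y)) (X Y : 𝔛) :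
    F.φ * F.φ * (A.lie K.ξ r X Y + 4 * K.b ^ 3 * K.ff X Y) = 0 := by
  have h1 := A.D_tr F (K.starOp X Y) K.ξ
  have h2 : F.tr (fun Z => A.brk K.ξ (K.starOp X Y Z) - K.starOp X Y (A.brk K.ξ Z))
      = F.tr (K.starOp (A.brk K.ξ X) Y) + F.tr (K.starOp X (A.brk K.ξ Y))
        - 2 * K.b ^ 3 * (F.tr (fun Z => (K.hForm (K.f Y) ∘ₗ K.f) Z • X)
          - F.tr (fun Z => (K.hForm X ∘ₗ K.f) Z • K.f Y)) := by
    simp only [CutoffFrame.tr, K.lie_starOp, map_sub, map_add, map_smul, Finset.sum_sub_distrib,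
      Finset.sum_add_distrib, ← Finset.mul_sum, smul_eq_mul, LinearMap.comp_apply]
  have h3 : K.hForm (K.f Y) (K.f X) = K.ff X Y := by
    simp [hForm, h, K.g_ξ_f, ff]
  have h4 : K.hForm X (K.f (K.f Y)) = -K.ff X Y := by
    change K.h _ _ = _
    rw [K.h_symm]
    simp [h, K.g_ξ_f, ff, K.g_f_f]
  rw [h2, F.tr_rank_one, F.tr_rank_one, ← hr, ← hr, ← hr, A.D_mul, LinearMap.comp_apply,
    LinearMap.comp_apply, h3, h4] at h1
  simp only [lie]
  linear_combination h1

section Soliton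

theorem lie_congr {S T : 𝔛 → 𝔛 → C} (hST : ∀ X Y, S X Y = T X Y) (W X Y : 𝔛) :
    A.lie W S X Y = A.lie W T X Y := by
  simp only [lie, hST]

theorem lie_const_mul {c : C} (hc : ∀ X, A.D X c = 0) (W : 𝔛) (T : 𝔛 → 𝔛 → C) (X Y : 𝔛) :
    A.lie W (fun X Y => c * T X Y) X Y = c * A.lie W T X Y := by
  simp only [lie, A.D_mul, hc]; ring

theorem lie_sub (W : 𝔛) (S T : 𝔛 → 𝔛 → C) (X Y : 𝔛) :
    A.lie W (fun X Y => S X Y - T X Y) X Y = A.lie W S X Y - A.lie W T X Y := by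
  simp only [lie, A.D_sub]; ring

theorem lie_add (W : 𝔛) (S T : 𝔛 → 𝔛 → C) (X Y : 𝔛) :
    A.lie W (fun X Y => S X Y + T X Y) X Y = A.lie W S X Y + A.lie W T X Y := by
  simp only [lie, A.D_add]; ring

/-- Lie derivatives of a bilinear form commute up to the Lie derivative along the bracket. -/
theorem lie_lie {E : 𝔛} (hE : A.g E E = 1) {T : 𝔛 → 𝔛 → C}
    (h1 : ∀ X X' Y, T (X + X') Y = T X Y + T X' Y)
    (h2 : ∀ X Y Y', T X (Y + Y') = T X Y + T X Y') (W W' X Y : 𝔛) :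
    A.lie W (A.lie W' T) X Y = A.lie W' (A.lie W T) X Y + A.lie (A.brk W W') T X Y := by
  simp only [lie, A.D_sub, A.D_brk hE, A.jacobi W W', h1, h2]
  ring

theorem lie_smul_field {c : C} (hc : ∀ X, A.D X c = 0) (W X Y : 𝔛) :
    A.lie (c • W) A.g X Y = c * A.lie W A.g X Y := by
  simp only [lie, A.D_smul_left, A.brk_smul_left, hc, A.g_smul, A.g_smul_left, zero_smul,
    neg_zero, zero_add]
  ring

theorem lie_sub_field (W W' X Y : 𝔛) :
    A.lie (W - W') A.g X Y = A.lie W A.g X Y - A.lie W' A.g X Y := by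
  simp only [lie, A.D_sub_left, A.brk_sub_left, A.g_sub, A.g_sub_left]
  ring

/-- The integrability condition of the `∗`-Ricci soliton equation `£_V g + 2 Ric^∗ = 2 l g`. -/
theorem soliton_condition (V : 𝔛) (r : 𝔛 → 𝔛 → C) (l : C) (hl : ∀ X, A.D X l = 0)
    (hr : ∀ X Y, A.lie K.ξ r X Y = -(4 * K.b ^ 3) * K.ff X Y) (hrξ : ∀ X, r X K.ξ = 0)
    (hV : ∀ X Y, A.lie V A.g X Y = 2 * l * A.g X Y - r X Y) (X Y : 𝔛) :
    4 * K.b ^ 2 * l * K.h X Y = 0 := by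
  set U := A.brk K.ξ V with hU
  have hVξ : A.brk V K.ξ = -U := A.brk_skew _ _
  have D2 (X : 𝔛) : A.D X (2 * K.b) = 0 := by rw [A.D_mul, A.D_ofNat, K.D_b]; ring
  have D2l (X : 𝔛) : A.D X (2 * l) = 0 := by rw [A.D_mul, A.D_ofNat, hl]; ring
  have D4 (X : 𝔛) : A.D X (4 * K.b ^ 3) = 0 := by
    rw [pow_succ, pow_two]; simp only [A.D_mul, A.D_ofNat, K.D_b]; ring
  -- commutators of `£_ξ` with `£_W` on `g`
  have hcomm (W X Y : 𝔛) : A.lie K.ξ (A.lie W A.g) X Y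
      = 2 * K.b * A.lie W K.h X Y + A.lie (A.brk K.ξ W) A.g X Y := by
    rw [lie_lie K.g_ξ_ξ A.g_add_left A.g_add, lie_congr K.lie_ξ_g, lie_const_mul D2]
  -- the first derivative of the equation
  have hB (X Y : 𝔛) : A.lie K.ξ (A.lie V A.g) X Y
      = 2 * l * (2 * K.b * K.h X Y) + 4 * K.b ^ 3 * K.ff X Y := by
    rw [lie_congr hV, lie_sub, lie_const_mul D2l, K.lie_ξ_g, hr]; ring
  have hη : A.g K.ξ U = l := by
    have h1 := hV K.ξ K.ξ
    simp only [lie, K.g_ξ_ξ, hVξ, A.D_one, A.g_neg, A.g_neg_left, hrξ, A.g_symm U] at h1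
    rw [← sub_eq_zero]
    apply A.two_torsion
    linear_combination h1
  have hηU (X : 𝔛) : A.D U (A.g K.ξ X) = A.g K.ξ (A.brk U X) := by
    have h1 := K.η_closed U X
    rwa [hη, hl, sub_zero] at h1
  have hU' : A.brk K.ξ U = (2 * K.b * l) • K.ξ - (2 * K.b) • U := by
    apply A.g_ext
    intro X
    have h1 := hcomm V X K.ξ
    rw [hB, K.h_ξ, ← hU] at h1
    have h2 : A.lie V K.h X K.ξ = K.h X U := by
      simp only [lie, K.h_ξ, A.D_zero, hVξ]
      simp only [h, A.g_neg]; ring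
    have h3 : A.lie U A.g X K.ξ = A.g X (A.brk K.ξ U) := by
      simp only [lie, A.g_symm _ K.ξ, hηU, A.brk_skew U K.ξ, A.g_neg]; ring
    have h4 : K.ff X K.ξ = 0 := by simp only [ff, K.f_ξ, A.g_zero]
    rw [h2, h3, h4] at h1
    simp only [A.g_sub_left, A.g_smul_left, A.g_symm _ X, h, hη] at h1 ⊢
    linear_combination -h1
  -- the second derivative of the equation
  have hηη (X Y : 𝔛) : A.lie K.ξ (A.lie V (fun X Y => A.g K.ξ X * A.g K.ξ Y)) X Y = 0 := by
    rw [lie_lie K.g_ξ_ξ (fun _ _ _ => by rw [A.g_add]; ring) (fun _ _ _ => by rw [A.g_add]; ring)]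
    have h1 (X Y : 𝔛) : A.lie K.ξ (fun X Y => A.g K.ξ X * A.g K.ξ Y) X Y = 0 := by
      simp only [lie, A.D_mul, K.D_ξ_η]; ring
    have h2 (X Y : 𝔛) : A.lie U (fun X Y => A.g K.ξ X * A.g K.ξ Y) X Y = 0 := by
      simp only [lie, A.D_mul, hηU]; ring
    rw [← hU, h2, add_zero]
    simp only [lie] at h1 ⊢
    simp only [h1, A.D_zero]; ring
  have hUh (X Y : 𝔛) : A.lie U K.h X Y = A.lie U A.g X Y := by
    simp only [lie, h, A.D_sub, A.D_mul, hηU]; ring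
  have hVh (X Y : 𝔛) : A.lie K.ξ (A.lie V K.h) X Y = A.lie K.ξ (A.lie V A.g) X Y := by
    have : ∀ X Y, A.lie V K.h X Y = A.lie V A.g X Y
        - A.lie V (fun X Y => A.g K.ξ X * A.g K.ξ Y) X Y := fun X Y => by
      rw [← lie_sub]; rfl
    rw [lie_congr this, lie_sub, hηη, sub_zero]
  have hM := lie_congr (A := A) (hcomm V) K.ξ X Y
  rw [lie_add, lie_const_mul D2, hVh, ← hU, hcomm U, hUh, hU', lie_sub_field,
    lie_smul_field D2, lie_smul_field (fun X => by rw [A.D_mul, D2, hl]; ring), K.lie_ξ_g] at hM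
  have hM' : A.lie K.ξ (A.lie K.ξ (A.lie V A.g)) X Y
      = 2 * K.b * A.lie K.ξ (A.lie V A.g) X Y := by
    rw [lie_congr hB, lie_add, lie_const_mul D2l, lie_const_mul D2, lie_const_mul D4, K.lie_ξ_h,
      K.lie_ξ_ff, hB]
    ring
  rw [hM'] at hM
  linear_combination -hM

end Soliton

end KenmotsuData

end RiemannianLieRinehart

section SmoothFields

variable {E : Type*} [NormedAddCommGroup E] [NormedSpace ℝ E] [FiniteDimensional ℝ E]
  {H : Type*} [TopologicalSpace H] (I : ModelWithCorners ℝ E H)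
  (M : Type*) [TopologicalSpace M] [ChartedSpace H M] [IsManifold I ∞ M]

/-- The ring of smooth functions. -/
abbrev SmoothFunction : Type _ := C^∞⟮I, M; 𝓘(ℝ, ℝ), ℝ⟯

/-- The module of smooth vector fields. -/
abbrev SmoothField : Type _ := Cₛ^∞⟮I; E, (TangentSpace I : M → Type _)⟯

variable {I M}

instance : SMul (SmoothFunction I M) (SmoothField I M) where
  smul a X := ⟨fun x => a x • X x, a.contMDiff.smul_section X.contMDiff⟩

theorem smul_field_apply (a : SmoothFunction I M) (X : SmoothField I M) (x : M) :
    (a • X) x = a x • X x := rfl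

instance : Module (SmoothFunction I M) (SmoothField I M) where
  one_smul X := by ext x; exact one_smul ℝ (X x)
  mul_smul a b X := by ext x; exact mul_smul (a x) (b x) (X x)
  smul_zero a := by ext x; exact smul_zero (a x)
  smul_add a X Y := by ext x; exact smul_add (a x) (X x) (Y x)
  add_smul a b X := by ext x; exact add_smul (a x) (b x) (X x)
  zero_smul X := by ext x; exact zero_smul ℝ (X x)

theorem SmoothFunction.mdiffAt (a : SmoothFunction I M) (x : M) : MDiffAt (a : M → ℝ) x :=
  a.contMDiff.mdifferentiableAt (by simp)

theorem SmoothField.mdiffAt (X : SmoothField I M) (x : M) :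
    MDiffAt (T% (X : Π x : M, TangentSpace I x)) x := X.mdifferentiableAt

theorem contMDiff_mvfderiv_apply {a : M → ℝ} (ha : ContMDiff I 𝓘(ℝ, ℝ) ∞ a)
    (X : SmoothField I M) : ContMDiff I 𝓘(ℝ, ℝ) ∞ (fun x => mvfderiv I a x (X x)) := by
  have h1 := ha.contMDiff_tangentMap (m := ∞) (by simp)
  have h2 := (contMDiff_snd_tangentBundle_modelSpace ℝ 𝓘(ℝ, ℝ) (n := ∞)).comp
    (h1.comp X.contMDiff)
  exact h2

/-- The derivative of a smooth function along a smooth field. -/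
def fieldDeriv (X : SmoothField I M) (a : SmoothFunction I M) : SmoothFunction I M :=
  ⟨fun x => mvfderiv I a x (X x), contMDiff_mvfderiv_apply a.contMDiff X⟩

/-- The Lie bracket of smooth fields. -/
def fieldBracket (X Y : SmoothField I M) : SmoothField I M :=
  ⟨mlieBracket I X Y, by
    intro x
    have : IsManifold I (((⊤ : ℕ∞) : WithTop ℕ∞) + 1) M := by
      simpa using (inferInstance : IsManifold I ∞ M)
    have : IsManifold I (minSmoothness ℝ 2) M := .of_le (n := ∞) (by simpa using ENat.LEInfty.out)
    exact ContMDiffAt.mlieBracket_vectorField (n := (⊤ : ℕ∞)) (m := (⊤ : ℕ∞))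
      (X.contMDiff x) (Y.contMDiff x) (by simp)⟩

theorem fieldBracket_jacobi (X Y Z : SmoothField I M) :
    fieldBracket X (fieldBracket Y Z)
      = fieldBracket (fieldBracket X Y) Z + fieldBracket Y (fieldBracket X Z) := by
  have : IsManifold I (minSmoothness ℝ 3) M := .of_le (n := ∞) (by simpa using ENat.LEInfty.out)
  have h : minSmoothness ℝ 2 ≤ (∞ : WithTop ℕ∞) := by simpa using ENat.LEInfty.out
  ext x
  exact leibniz_identity_mlieBracket_apply ((X.contMDiff x).of_le h) ((Y.contMDiff x).of_le h)
    ((Z.contMDiff x).of_le h)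

variable (g : ContMDiffRiemannianMetric I ∞ E (fun x : M => TangentSpace I x))

/-- The smooth function `g(X, Y)`. -/
def fieldPairing (X Y : SmoothField I M) : SmoothFunction I M :=
  ⟨pairing g X Y, by
    have h : ContMDiff I (I.prod 𝓘(ℝ, ℝ)) ∞
        (fun m ↦ TotalSpace.mk' ℝ (E := Bundle.Trivial M ℝ) m (g.inner m (X m) (Y m))) :=
      ContMDiff.clm_bundle_apply₂ (F₁ := E) (F₂ := E) g.contMDiff X.contMDiff Y.contMDiff
    intro x
    exact ((contMDiffAt_section x).1 (h x))⟩

/-- A smooth endomorphism acting on smooth fields. -/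
def fieldEndo (f : Π x : M, TangentSpace I x →L[ℝ] TangentSpace I x) (hf : IsSmoothEndo f) :
    SmoothField I M →ₗ[SmoothFunction I M] SmoothField I M where
  toFun X := ⟨fun x => f x (X x),
    ContMDiff.clm_bundle_apply (F₁ := E) (F₂ := E) hf X.contMDiff⟩
  map_add' X Y := by ext x; exact map_add (f x) (X x) (Y x)
  map_smul' a X := by ext x; exact map_smul (f x) (a x) (X x)

section Cutoff

variable [T2Space M]

theorem exists_cutoff {U : Set M} (hU : IsOpen U) {x : M} (hx : x ∈ U) :
    ∃ ψ : SmoothFunction I M, (∀ᶠ y in nhds x, ψ y = 1) ∧ tsupport ψ ⊆ U := by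
  obtain ⟨ρ, -, hρ⟩ := (SmoothBumpFunction.nhds_basis_tsupport (I := I) x).mem_iff.1
    (hU.mem_nhds hx)
  exact ⟨⟨ρ, ρ.contMDiff⟩, ρ.eventuallyEq_one, hρ⟩

theorem exists_field_of_contMDiffOn {U : Set M} (hU : IsOpen U) {x : M} (hx : x ∈ U)
    {X : Π x : M, TangentSpace I x} (hX : ContMDiffOn I (I.prod 𝓘(ℝ, E)) ∞
      (fun x => TotalSpace.mk' E x (X x)) U) :
    ∃ Y : SmoothField I M, ∀ᶠ y in nhds x, Y y = X y := by
  obtain ⟨ψ, h1, h2⟩ := exists_cutoff (I := I) hU hx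
  refine ⟨⟨(ψ : M → ℝ) • X, ContMDiffOn.smul_section_of_tsupport ψ.contMDiff.contMDiffOn hU h2 hX⟩,
    ?_⟩
  filter_upwards [h1] with y hy
  simp [hy]

theorem exists_field_eventuallyEq_extend (x : M) (v : TangentSpace I x) :
    ∃ Y : SmoothField I M, ∀ᶠ y in nhds x, Y y = FiberBundle.extend E v y := by
  obtain ⟨s, hs, h⟩ := FiberBundle.exists_contMDiffOn_extend (k := ∞) I E v
  obtain ⟨U, hUs, hU, hx⟩ := mem_nhds_iff.1 hs
  exact exists_field_of_contMDiffOn hU hx (h.mono hUs)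

theorem exists_field_apply_eq (x : M) (v : TangentSpace I x) :
    ∃ Y : SmoothField I M, Y x = v := by
  obtain ⟨Y, hY⟩ := exists_field_eventuallyEq_extend (I := I) x v
  exact ⟨Y, by simpa using hY.self_of_nhds⟩

end Cutoff

end SmoothFields

section Frames

variable {E : Type*} [NormedAddCommGroup E] [NormedSpace ℝ E] [FiniteDimensional ℝ E]
  {H : Type*} [TopologicalSpace H] {I : ModelWithCorners ℝ E H}
  {M : Type*} [TopologicalSpace M] [ChartedSpace H M] [IsManifold I ∞ M]

theorem sum_field_apply {ι : Type*} (s : Finset ι) (X : ι → SmoothField I M) (x : M) :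
    (∑ i ∈ s, X i) x = ∑ i ∈ s, X i x := by
  classical
  induction s using Finset.induction_on with
  | empty => rfl
  | insert a s ha ih =>
    rw [Finset.sum_insert ha, Finset.sum_insert ha, ← ih]; rfl

theorem sum_function_apply {ι : Type*} (s : Finset ι) (a : ι → SmoothFunction I M) (x : M) :
    (∑ i ∈ s, a i) x = ∑ i ∈ s, a i x := by
  classical
  induction s using Finset.induction_on with
  | empty => rfl
  | insert j s hj ih =>
    rw [Finset.sum_insert hj, Finset.sum_insert hj, ← ih]; rfl

/-- Around each point there is a cut-off frame, and it computes traces of endomorphisms. -/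
theorem exists_cutoffFrame [T2Space M] (x : M) :
    ∃ F : RiemannianLieRinehart.CutoffFrame (SmoothFunction I M) (SmoothField I M)
        (Fin (Module.finrank ℝ E)),
      F.φ x = 1 ∧ (∀ i (X : SmoothField I M) y, X y = 0 → F.θ i X y = 0) ∧
      ∀ (y : M) (T : TangentSpace I y →ₗ[ℝ] TangentSpace I y)
        (Φ : SmoothField I M → SmoothField I M), (∀ Z, Φ Z y = T (Z y)) →
        F.tr Φ y = F.φ y * LinearMap.trace ℝ (TangentSpace I y) T := by
  set t := trivializationAt E (TangentSpace I : M → Type _) x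
  have hxt : x ∈ t.baseSet := FiberBundle.mem_baseSet_trivializationAt' x
  obtain ⟨ψ, h1, h2⟩ := exists_cutoff (I := I) t.open_baseSet hxt
  let b := Module.finBasis ℝ E
  let s := t.localFrame b
  let c := t.localFrameCoeff I b
  have hψ {y : M} (hy : y ∉ t.baseSet) : ψ y = 0 := by
    by_contra h
    exact hy (h2 (subset_tsupport _ h))
  let e (i) : SmoothField I M := ⟨(ψ : M → ℝ) • s i,
    ContMDiffOn.smul_section_of_tsupport ψ.contMDiff.contMDiffOn t.open_baseSet h2
      (t.contMDiffOn_localFrame_baseSet ∞ b i)⟩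
  let θ (i) : SmoothField I M →ₗ[SmoothFunction I M] SmoothFunction I M :=
    { toFun := fun X => ⟨fun y => ψ y * c i y (X y), by
        refine contMDiff_of_tsupport fun y hy => ?_
        have hy' := h2 (tsupport_mul_subset_left hy)
        exact (ψ.contMDiff y).mul
          (contMDiffAt_localFrameCoeff b hy' (X.contMDiff y) i)⟩
      map_add' := fun X Y => by
        ext y
        change ψ y * c i y (X y + Y y) = ψ y * c i y (X y) + ψ y * c i y (Y y)
        rw [map_add, mul_add]
      map_smul' := fun a X => by
        ext y
        change ψ y * c i y (a y • X y) = a y * (ψ y * c i y (X y))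
        rw [map_smul, smul_eq_mul]; ring }
  have hs {y : M} (hy : y ∈ t.baseSet) (i) : s i y = t.basisAt b hy i :=
    t.localFrame_apply_of_mem_baseSet b hy
  have hc {y : M} (hy : y ∈ t.baseSet) (i) (v : TangentSpace I y) :
      c i y v = (t.basisAt b hy).repr v i := by
    have := t.localFrameCoeff_apply_of_mem_baseSet (I := I) b hy (FiberBundle.extend E v) i
    simpa using this
  have he (i y) : e i y = ψ y • s i y := rfl
  have hθ (i) (X : SmoothField I M) (y) : θ i X y = ψ y * c i y (X y) := rfl
  refine ⟨⟨e, θ, ψ * ψ, fun X => ?_, fun i j => ?_⟩, ?_, fun i X y hX => ?_,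
    fun y T Φ hΦ => ?_⟩
  · ext y
    rw [sum_field_apply]
    simp only [smul_field_apply, he, hθ, ContMDiffMap.coe_mul, Pi.mul_apply]
    by_cases hy : y ∈ t.baseSet
    · conv_lhs => rw [← (t.basisAt b hy).sum_repr (X y), Finset.smul_sum]
      refine Finset.sum_congr rfl fun i _ => ?_
      rw [hs hy, hc hy, smul_smul, smul_smul]
      congr 1; ring
    · simp [hψ hy]
  · ext y
    simp only [hθ, he]
    by_cases hy : y ∈ t.baseSet
    · rw [map_smul, hs hy, hc hy, Module.Basis.repr_self, smul_eq_mul]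
      split_ifs with h
      · subst h; simp
      · rw [Finsupp.single_eq_of_ne h]; simp
    · rw [hψ hy]
      split_ifs <;> simp [hψ hy]
  · simp [h1.self_of_nhds]
  · rw [hθ, hX, map_zero, mul_zero]
  · change (∑ i, θ i (Φ (e i))) y = ψ y * ψ y * _
    rw [sum_function_apply]
    simp only [hθ, hΦ, he]
    by_cases hy : y ∈ t.baseSet
    · rw [LinearMap.trace_eq_matrix_trace ℝ (t.basisAt b hy), Matrix.trace, Finset.mul_sum]
      refine Finset.sum_congr rfl fun i _ => ?_
      rw [Matrix.diag_apply, LinearMap.toMatrix_apply, map_smul, map_smul, hs hy, hc hy,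
        smul_eq_mul, mul_assoc]
    · simp [hψ hy]

variable (g : ContMDiffRiemannianMetric I ∞ E (fun x : M => TangentSpace I x))

theorem contMDiffAt_det {ι : Type*} [Fintype ι] [DecidableEq ι] {G : M → Matrix ι ι ℝ} {x : M}
    (hG : ∀ i j, ContMDiffAt I 𝓘(ℝ, ℝ) ∞ (fun y => G y i j) x) :
    ContMDiffAt I 𝓘(ℝ, ℝ) ∞ (fun y => (G y).det) x := by
  simp only [Matrix.det_apply']
  exact ContMDiffAt.sum fun σ _ => contMDiffAt_const.mul (contMDiffAt_finsetProd fun i _ => hG _ _)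

theorem contMDiffAt_matrix_inv {ι : Type*} [Fintype ι] [DecidableEq ι] {G : M → Matrix ι ι ℝ}
    {x : M} (hG : ∀ i j, ContMDiffAt I 𝓘(ℝ, ℝ) ∞ (fun y => G y i j) x) (hx : (G x).det ≠ 0)
    (i j : ι) : ContMDiffAt I 𝓘(ℝ, ℝ) ∞ (fun y => (G y)⁻¹ i j) x := by
  simp only [Matrix.inv_def, Ring.inverse_eq_inv', Matrix.smul_apply, smul_eq_mul,
    Matrix.adjugate_apply]
  refine ContMDiffAt.mul ((contMDiffAt_det hG).inv₀ hx) (contMDiffAt_det fun k l => ?_)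
  by_cases hk : k = j
  · subst hk
    simp only [Matrix.updateRow_self]
    exact contMDiffAt_const
  · simp only [Matrix.updateRow_ne hk]
    exact hG k l

/-- A field is smooth if its inner products with smooth fields are. -/
theorem contMDiff_of_pairing [T2Space M] {W : Π x : M, TangentSpace I x}
    (hW : ∀ Z : SmoothField I M, ContMDiff I 𝓘(ℝ, ℝ) ∞ (pairing g W Z)) :
    ContMDiff I (I.prod 𝓘(ℝ, E)) ∞ (fun x => TotalSpace.mk' E x (W x)) := by
  intro x
  set t := trivializationAt E (TangentSpace I : M → Type _) x
  have hxt : x ∈ t.baseSet := FiberBundle.mem_baseSet_trivializationAt' x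
  let b := Module.finBasis ℝ E
  let s := t.localFrame b
  let c := t.localFrameCoeff I b
  have hs {y : M} (hy : y ∈ t.baseSet) (i) : s i y = t.basisAt b hy i :=
    t.localFrame_apply_of_mem_baseSet b hy
  choose e he using fun i => exists_field_of_contMDiffOn t.open_baseSet hxt
    (t.contMDiffOn_localFrame_baseSet (I := I) ∞ b i)
  let G (y : M) : Matrix (Fin (Module.finrank ℝ E)) (Fin (Module.finrank ℝ E)) ℝ :=
    fun i j => g.inner y (e j y) (e i y)
  have hev : ∀ᶠ y in nhds x, y ∈ t.baseSet ∧ ∀ i, e i y = s i y :=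
    (t.open_baseSet.eventually_mem hxt).and (Filter.eventually_all.2 he)
  have hdet {y : M} (hy : y ∈ t.baseSet ∧ ∀ i, e i y = s i y) : (G y).det ≠ 0 := by
    intro h0
    obtain ⟨v, hv, hGv⟩ := Matrix.exists_mulVec_eq_zero_iff.2 h0
    have h1 : ∑ i, v i • e i y = 0 := by
      by_contra hne
      have h2 (j) : g.inner y (∑ i, v i • e i y) (e j y) = 0 := by
        rw [map_sum, sum_apply]
        simpa [Matrix.mulVec, dotProduct, G, mul_comm, g.symm y (e _ y) (e j y)]
          using congrFun hGv j
      have h3 (L : TangentSpace I y →L[ℝ] ℝ) (hL : ∀ j, L (e j y) = 0) :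
          L (∑ i, v i • e i y) = 0 := by simp [hL]
      exact absurd (g.pos y _ hne) (by rw [h3 _ h2]; simp)
    apply hv
    have h2 : (t.basisAt b hy.1).repr (∑ i, v i • e i y) = 0 := by rw [h1, map_zero]
    funext i
    simpa [hy.2, hs hy.1, Finsupp.single_apply] using DFunLike.congr_fun h2 i
  rw [contMDiffAt_iff_localFrameCoeff b hxt]
  intro i
  have hsm : ContMDiffAt I 𝓘(ℝ, ℝ) ∞
      (fun y => ((G y)⁻¹.mulVec fun j => pairing g W (e j) y) i) x := by
    simp only [Matrix.mulVec, dotProduct]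
    refine ContMDiffAt.sum fun j _ => ContMDiffAt.mul ?_ (hW (e j) x)
    exact contMDiffAt_matrix_inv (fun i j => (fieldPairing g (e j) (e i)).contMDiff x)
      (hdet hev.self_of_nhds) i j
  refine hsm.congr_of_eventuallyEq ?_
  filter_upwards [hev] with y hy
  have h1 : (fun j => pairing g W (e j) y) = (G y).mulVec (fun i => c i y (W y)) := by
    funext j
    have := t.eq_sum_localFrameCoeff_smul (I := I) (b := b) (s := W) hy.1
    change g.inner y (W y) (e j y) = ∑ i, g.inner y (e i y) (e j y) * c i y (W y)
    conv_lhs => rw [this, map_sum, sum_apply]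
    refine Finset.sum_congr rfl fun i _ => ?_
    rw [hy.2 i, map_smul, smul_apply, smul_eq_mul, mul_comm]
  rw [h1, Matrix.mulVec_mulVec, Matrix.nonsing_inv_mul _ (Ne.isUnit (hdet hy)), Matrix.one_mulVec]
  rfl

end Frames

section Connection

variable {E : Type*} [NormedAddCommGroup E] [NormedSpace ℝ E] [FiniteDimensional ℝ E]
  {H : Type*} [TopologicalSpace H] {I : ModelWithCorners ℝ E H}
  {M : Type*} [TopologicalSpace M] [ChartedSpace H M] [IsManifold I ∞ M] [T2Space M]
  (g : ContMDiffRiemannianMetric I ∞ E (fun x : M => TangentSpace I x))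

/-- The Levi-Civita covariant derivative of smooth fields. -/
def fieldNabla (X Y : SmoothField I M) : SmoothField I M :=
  ⟨fun x => leviCivita g Y x (X x), contMDiff_of_pairing g fun Z => by
    have h : pairing g (fun x => leviCivita g Y x (X x)) Z
        = fun x => 1 / 2 * (fieldDeriv X (fieldPairing g Y Z) + fieldDeriv Y (fieldPairing g X Z)
          - fieldDeriv Z (fieldPairing g X Y) + fieldPairing g (fieldBracket X Y) Z
          - fieldPairing g (fieldBracket X Z) Y - fieldPairing g (fieldBracket Y Z) X :
          SmoothFunction I M) x := by
      funext x
      exact inner_leviCivita g (X.mdiffAt x) (Y.mdiffAt x) (Z.mdiffAt x)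
    rw [h]
    exact contMDiff_const.mul (ContMDiffMap.contMDiff _)⟩

/-- The smooth fields of a Riemannian manifold. -/
def riemannianLieRinehart :
    RiemannianLieRinehart (SmoothFunction I M) (SmoothField I M) where
  D := fieldDeriv
  brk := fieldBracket
  g := fieldPairing g
  nab := fieldNabla g
  D_add X a b := by
    ext x
    change mvfderiv I (⇑a + ⇑b) x (X x) = _
    rw [mvfderiv_add (a.mdiffAt x) (b.mdiffAt x)]; rfl
  D_mul X a b := by
    ext x
    change mvfderiv I (⇑a * ⇑b) x (X x) = mvfderiv I a x (X x) * b x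
      + a x * mvfderiv I b x (X x)
    rw [mvfderiv_mul (a.mdiffAt x) (b.mdiffAt x)]
    simp only [add_apply, smul_apply, smul_eq_mul]
    ring
  D_smul_left a X b := by ext x; exact map_smul (mvfderiv I b x) (a x) (X x)
  D_add_left X Y b := by ext x; exact map_add (mvfderiv I b x) (X x) (Y x)
  brk_skew X Y := by ext x; exact mlieBracket_swap_apply
  brk_add X Y Z := by
    ext x
    exact mlieBracket_add_right (Y.mdiffAt x) (Z.mdiffAt x)
  brk_smul X a Y := by
    ext x
    exact mlieBracket_smul_right (a.mdiffAt x) (Y.mdiffAt x)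
  jacobi := fieldBracket_jacobi
  g_symm X Y := by ext x; exact g.symm x _ _
  g_add X Y Z := by ext x; exact map_add (g.inner x (X x)) (Y x) (Z x)
  g_smul X a Y := by ext x; exact map_smul (g.inner x (X x)) (a x) (Y x)
  g_ext X Y h := by
    ext x
    apply metric_injective g x
    ext z
    obtain ⟨Z, rfl⟩ := exists_field_apply_eq (I := I) x z
    exact DFunLike.congr_fun (h Z) x
  nab_add_left X Y Z := by ext x; exact map_add (leviCivita g Z x) (X x) (Y x)
  nab_smul_left a X Y := by ext x; exact map_smul (leviCivita g Y x) (a x) (X x)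
  nab_add X Y Z := by
    ext x
    exact DFunLike.congr_fun ((leviCivita g).isCovariantDerivativeOnUniv.add (Y.mdiffAt x)
      (Z.mdiffAt x)) (X x)
  nab_smul X a Y := by
    ext x
    have := DFunLike.congr_fun ((leviCivita g).isCovariantDerivativeOnUniv.leibniz (Y.mdiffAt x)
      (a.mdiffAt x)) (X x)
    refine this.trans ?_
    change _ = mvfderiv I a x (X x) • Y x + a x • leviCivita g Y x (X x)
    rw [add_comm]
    rfl
  torsion X Y := by ext x; exact leviCivita_torsion g (X.mdiffAt x) (Y.mdiffAt x)
  metric X Y Z := by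
    ext x
    exact leviCivita_metric g (X.mdiffAt x) (Y.mdiffAt x) (Z.mdiffAt x)
  two_torsion a h := by
    ext x
    have : a x + a x = 0 := DFunLike.congr_fun h x
    change a x = 0
    linarith

open Filter Topology in
theorem leviCivita_congr {Y Y' : Π x : M, TangentSpace I x} {x : M} (h : Y =ᶠ[𝓝 x] Y') :
    leviCivita g Y x = leviCivita g Y' x := by
  have hT : (T% Y) =ᶠ[𝓝 x] (T% Y') := h.mono fun y hy => by simp only [hy]
  by_cases hY : MDiffAt (T% Y) x
  · exact (leviCivita g).isCovariantDerivativeOnUniv.congr_of_eventuallyEq hY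
      (hY.congr_of_eventuallyEq hT.symm) Filter.univ_mem h
  · have hY' : ¬ MDiffAt (T% Y') x := fun h' => hY (h'.congr_of_eventuallyEq hT)
    change leviCivitaFun g Y x = leviCivitaFun g Y' x
    rw [leviCivitaFun, leviCivitaFun, dif_neg hY, dif_neg hY']

open Filter Topology in
theorem curvatureField_congr {X X' Y Y' Z Z' : Π x : M, TangentSpace I x} {x : M}
    (hX : X =ᶠ[𝓝 x] X') (hY : Y =ᶠ[𝓝 x] Y') (hZ : Z =ᶠ[𝓝 x] Z') :
    curvatureField g X Y Z x = curvatureField g X' Y' Z' x := by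
  have h {W W' : Π x : M, TangentSpace I x} (hW : W =ᶠ[𝓝 x] W') :
      (fun y => leviCivita g Z y (W y)) =ᶠ[𝓝 x] fun y => leviCivita g Z' y (W' y) := by
    filter_upwards [hW, hZ.eventuallyEq_nhds] with y h1 h2
    rw [h1, leviCivita_congr g h2]
  rw [curvatureField, curvatureField, leviCivita_congr g (h hX), leviCivita_congr g (h hY),
    leviCivita_congr g hZ, hX.self_of_nhds, hY.self_of_nhds, hX.mlieBracket_vectorField_eq hY]

/-- A linear operator on smooth fields acts pointwise. -/
theorem linear_apply_eq (T : SmoothField I M →ₗ[SmoothFunction I M] SmoothField I M)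
    {X Y : SmoothField I M} {x : M} (h : X x = Y x) : T X x = T Y x := by
  have key (Z : SmoothField I M) (hZ : Z x = 0) : T Z x = 0 := by
    obtain ⟨F, h1, h2, -⟩ := exists_cutoffFrame (I := I) x
    have h3 := congrArg (fun W : SmoothField I M => W x) (congrArg T (F.expand Z))
    simp only [map_smul, map_sum, sum_field_apply, smul_field_apply, h1, h2 _ Z x hZ, zero_smul,
      one_smul, Finset.sum_const_zero] at h3
    exact h3
  rw [← sub_eq_zero]
  have := key (X - Y) (by change X x - Y x = 0; rw [h, sub_self])
  rwa [map_sub] at this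

/-- The action of a linear operator on smooth fields on a tangent space. -/
theorem exists_linearMap_apply_eq (T : SmoothField I M →ₗ[SmoothFunction I M] SmoothField I M)
    (x : M) : ∃ L : TangentSpace I x →ₗ[ℝ] TangentSpace I x, ∀ Z, T Z x = L (Z x) := by
  choose e he using fun v => exists_field_apply_eq (I := I) x v
  refine ⟨⟨⟨fun v => T (e v) x, fun v w => ?_⟩, fun c v => ?_⟩, fun Z => ?_⟩
  · have h : T (e (v + w)) x = T (e v + e w) x :=
      linear_apply_eq T ((he _).trans (congrArg₂ (· + ·) (he v) (he w)).symm)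
    rw [h, map_add]; rfl
  · let a : SmoothFunction I M := ⟨fun _ => c, contMDiff_const⟩
    have h : T (e (c • v)) x = T (a • e v) x :=
      linear_apply_eq T ((he _).trans (congrArg (c • ·) (he v)).symm)
    exact h.trans (by rw [map_smul]; rfl)
  · exact linear_apply_eq T (he _).symm

/-- Curvature at a point is the value of the curvature of smooth fields. -/
theorem curvatureAt_apply {W : SmoothField I M} (hW : fieldPairing g W W = 1)
    (X Y Z : SmoothField I M) (x : M) :
    curvatureAt g x (X x) (Y x) (Z x) = (riemannianLieRinehart g).curv X Y Z x := by
  set A := riemannianLieRinehart g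
  obtain ⟨X', hX⟩ := exists_field_eventuallyEq_extend x (X x)
  obtain ⟨Y', hY⟩ := exists_field_eventuallyEq_extend x (Y x)
  obtain ⟨Z', hZ⟩ := exists_field_eventuallyEq_extend x (Z x)
  have h1 : curvatureAt g x (X x) (Y x) (Z x) = A.curv X' Y' Z' x :=
    (curvatureField_congr g hX hY hZ).symm
  rw [h1]
  let T1 : SmoothField I M →ₗ[SmoothFunction I M] SmoothField I M :=
    ⟨⟨fun X => A.curv X Y' Z', fun _ _ => A.curv_add_left _ _ _ _⟩,
      fun _ _ => A.curv_smul_left _ _ _ _⟩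
  let T2 : SmoothField I M →ₗ[SmoothFunction I M] SmoothField I M :=
    ⟨⟨fun Y => A.curv X Y Z', fun _ _ => A.curv_add_middle _ _ _ _⟩,
      fun _ _ => A.curv_smul_middle _ _ _ _⟩
  let T3 : SmoothField I M →ₗ[SmoothFunction I M] SmoothField I M :=
    ⟨⟨fun Z => A.curv X Y Z, fun _ _ => A.curv_add_right _ _ _ _⟩,
      fun _ _ => A.curv_smul_right hW _ _ _ _⟩
  have e1 : T1 X' x = T1 X x := linear_apply_eq T1 (by simpa using hX.self_of_nhds)
  have e2 : T2 Y' x = T2 Y x := linear_apply_eq T2 (by simpa using hY.self_of_nhds)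
  have e3 : T3 Z' x = T3 Z x := linear_apply_eq T3 (by simpa using hZ.self_of_nhds)
  exact e1.trans (e2.trans e3)

end Connection

section Structures

variable {n : ℕ} {M : Type*} [TopologicalSpace M]
  [ChartedSpace (EuclideanSpace ℝ (Fin (2 * n + 1))) M] [IsManifold (𝓡 (2 * n + 1)) ∞ M]
  (S : WeakAlmostContactMetric n M)

namespace WeakAlmostContactMetric

theorem eq_of_f_eq_zero {x : M} {u : TangentSpace (𝓡 (2 * n + 1)) x} (hu : S.f x u = 0) :
    u = S.η x u • S.ξ x := by
  apply (S.nonsingular_Q x).1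
  have h := S.f_sq x u
  rw [hu, map_zero] at h
  rw [map_smul, S.Q_ξ]
  rw [eq_comm, neg_add_eq_zero] at h
  exact h

theorem f_ξ (x : M) : S.f x (S.ξ x) = 0 := by
  have h0 : S.f x (S.f x (S.ξ x)) = 0 := by
    rw [S.f_sq, S.Q_ξ, S.η_ξ, one_smul, neg_add_cancel]
  have h1 := S.eq_of_f_eq_zero h0
  rw [h1, map_smul] at h0
  rcases smul_eq_zero.1 h0 with h | h
  · rw [h1, h, zero_smul]
  · exact h

theorem inner_ξ (x : M) (v : TangentSpace (𝓡 (2 * n + 1)) x) :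
    S.g.inner x (S.ξ x) v = S.η x v := by
  have h := S.compat x v (S.ξ x)
  rw [S.f_ξ, map_zero, S.Q_ξ, S.η_ξ, mul_one] at h
  rw [S.g.symm]
  linarith

theorem η_f (x : M) (v : TangentSpace (𝓡 (2 * n + 1)) x) : S.η x (S.f x v) = 0 := by
  have h := S.f_invariant x (v - S.η x v • S.ξ x) (by rw [map_sub, map_smul, S.η_ξ]; simp)
  rwa [map_sub, map_smul, S.f_ξ, smul_zero, sub_zero] at h

theorem inner_f_f (x : M) (v w : TangentSpace (𝓡 (2 * n + 1)) x) :
    S.g.inner x v (S.f x (S.f x w)) = -S.g.inner x (S.f x v) (S.f x w) := by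
  rw [S.compat, S.f_sq, map_add, map_neg, map_smul, S.g.symm x v (S.ξ x), S.inner_ξ, smul_eq_mul]
  ring

end WeakAlmostContactMetric

theorem starRicci_eq_trace {E : Type*} [NormedAddCommGroup E] [NormedSpace ℝ E]
    [FiniteDimensional ℝ E] {H : Type*} [TopologicalSpace H] {I : ModelWithCorners ℝ E H}
    {M : Type*} [TopologicalSpace M] [ChartedSpace H M] [IsManifold I ∞ M]
    (g : ContMDiffRiemannianMetric I ∞ E (fun x : M => TangentSpace I x))
    (f : Π x : M, TangentSpace I x →L[ℝ] TangentSpace I x) (x : M) (u v : TangentSpace I x)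
    (T : TangentSpace I x →ₗ[ℝ] TangentSpace I x)
    (hT : ∀ w, T w = curvatureAt g x u (f x v) (f x w)) :
    starRicci g f x u v = 1 / 2 * LinearMap.trace ℝ (TangentSpace I x) T := by
  have : FiniteDimensional ℝ (TangentSpace I x) := inferInstanceAs (FiniteDimensional ℝ E)
  rw [LinearMap.trace_eq_matrix_trace ℝ (Module.finBasis ℝ (TangentSpace I x)), Matrix.trace]
  simp only [Matrix.diag_apply, LinearMap.toMatrix_apply, hT]
  rfl

variable [T2Space M] {S} {β : ℝ}

/-- Evaluation of smooth functions at a point. -/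
def evalAt (x : M) : SmoothFunction (𝓡 (2 * n + 1)) M →+* ℝ := ContMDiffMap.evalRingHom x

theorem evalAt_apply (x : M) (a : SmoothFunction (𝓡 (2 * n + 1)) M) : evalAt x a = a x := rfl

/-- The constant function. -/
def constFunction (c : ℝ) : SmoothFunction (𝓡 (2 * n + 1)) M := ⟨fun _ => c, contMDiff_const⟩

theorem fieldDeriv_constFunction (c : ℝ) (X : SmoothField (𝓡 (2 * n + 1)) M) :
    fieldDeriv X (constFunction c) = 0 := by
  ext x
  change mvfderiv (𝓡 (2 * n + 1)) (fun _ : M => c) x (X x) = 0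
  rw [mvfderiv_const]; rfl

/-- The identities satisfied by the smooth fields of a weak Kenmotsu manifold. -/
def IsWeakKenmotsu.data (hS : IsWeakKenmotsu S β) :
    (riemannianLieRinehart S.g).KenmotsuData :=
  let ξ : SmoothField (𝓡 (2 * n + 1)) M := ⟨S.ξ, S.smooth_ξ⟩
  have hξξ : fieldPairing S.g ξ ξ = 1 := by
    ext x
    exact (S.inner_ξ x (S.ξ x)).trans (S.η_ξ x)
  have hfξ : fieldEndo S.f S.smooth_f ξ = 0 := by ext x; exact S.f_ξ x
  have hf (X Y : SmoothField (𝓡 (2 * n + 1)) M) (x : M) :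
      fieldNabla S.g X (fieldEndo S.f S.smooth_f Y) x - S.f x (fieldNabla S.g X Y x)
        = β • (S.g.inner x (S.f x (X x)) (Y x) • S.ξ x - S.η x (Y x) • S.f x (X x)) :=
    hS.nabla_f X Y X.contMDiff Y.contMDiff x
  { ξ := ξ
    b := constFunction β
    f := fieldEndo S.f S.smooth_f
    D_b := fieldDeriv_constFunction β
    g_ξ_ξ := hξξ
    nab_ξ := fun X => by
      ext x
      change fieldNabla S.g X ξ x = β • (X x - S.g.inner x (S.ξ x) (X x) • S.ξ x)
      have h1 := hf X ξ x
      have h2 : fieldNabla S.g X (0 : SmoothField (𝓡 (2 * n + 1)) M) = 0 := by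
        have h : (riemannianLieRinehart S.g).nab X 0 = 0 := by
          simpa using (riemannianLieRinehart S.g).nab_sub X 0 0
        exact h
      have h3 : S.g.inner x (S.ξ x) (fieldNabla S.g X ξ x) = 0 := by
        have h := DFunLike.congr_fun ((riemannianLieRinehart S.g).metric X ξ ξ) x
        change fieldDeriv X (fieldPairing S.g ξ ξ) x
          = S.g.inner x (fieldNabla S.g X ξ x) (S.ξ x)
            + S.g.inner x (S.ξ x) (fieldNabla S.g X ξ x) at h
        have h' : fieldDeriv X (1 : SmoothFunction (𝓡 (2 * n + 1)) M) x = 0 :=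
          DFunLike.congr_fun ((riemannianLieRinehart S.g).D_one X) x
        rw [hξξ, h', S.g.symm x _ (S.ξ x)] at h
        linarith
      have h4 : S.f x (fieldNabla S.g X ξ x - β • X x) = 0 := by
        rw [hfξ, h2] at h1
        change (0 : TangentSpace (𝓡 (2 * n + 1)) x) - _
          = β • (S.g.inner x (S.f x (X x)) (S.ξ x) • S.ξ x - S.η x (S.ξ x) • S.f x (X x)) at h1
        rw [S.g.symm, S.inner_ξ, S.η_f, S.η_ξ, zero_smul, one_smul, zero_sub, zero_sub, smul_neg,
          neg_inj] at h1
        rw [map_sub, map_smul, h1, sub_self]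
      have h5 := S.eq_of_f_eq_zero h4
      rw [← S.inner_ξ, map_sub, h3, map_smul, smul_eq_mul, sub_eq_iff_eq_add] at h5
      rw [h5]
      module
    nab_ξ_f := fun Y => by
      ext x
      have h1 := hf ξ Y x
      change _ = β • (S.g.inner x (S.f x (S.ξ x)) (Y x) • S.ξ x
        - S.η x (Y x) • S.f x (S.ξ x)) at h1
      rw [S.f_ξ, map_zero, zero_apply, zero_smul, smul_zero, sub_zero, smul_zero, sub_eq_zero] at h1
      exact h1
    f_ξ := hfξ
    g_ξ_f := fun Y => by
      ext x
      exact (S.inner_ξ x _).trans (S.η_f x (Y x))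
    g_f_f := fun X Y => by
      ext x
      exact S.inner_f_f x (X x) (Y x) }

/-- Twice the `∗`-Ricci tensor is the trace of `Z ↦ R_{X, f Y} (f Z)` in every cut-off frame. -/
theorem trace_starOp (hS : IsWeakKenmotsu S β) (X Y : SmoothField (𝓡 (2 * n + 1)) M) (x : M) :
    ∃ T : TangentSpace (𝓡 (2 * n + 1)) x →ₗ[ℝ] TangentSpace (𝓡 (2 * n + 1)) x,
      (∀ Z, hS.data.starOp X Y Z x = T (Z x)) ∧
      2 * starRicci S.g S.f x (X x) (Y x)
        = LinearMap.trace ℝ (TangentSpace (𝓡 (2 * n + 1)) x) T := by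
  obtain ⟨T, hT⟩ := exists_linearMap_apply_eq (hS.data.starOp X Y) x
  refine ⟨T, hT, ?_⟩
  rw [starRicci_eq_trace S.g S.f x (X x) (Y x) T fun w => ?_]
  · ring
  · obtain ⟨Z, rfl⟩ := exists_field_apply_eq (I := 𝓡 (2 * n + 1)) x w
    rw [← hT, RiemannianLieRinehart.KenmotsuData.starOp_apply]
    exact (curvatureAt_apply S.g hS.data.g_ξ_ξ X (fieldEndo S.f S.smooth_f Y)
      (fieldEndo S.f S.smooth_f Z) x).symm

/-- The soliton constant of a `∗`-Ricci soliton on a weak Kenmotsu manifold vanishes. -/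
theorem IsStarRicciSoliton.eq_zero [Nonempty M] (hn : 1 ≤ n) (hS : IsWeakKenmotsu S β)
    {V : Π x : M, TangentSpace (𝓡 (2 * n + 1)) x} {lam : ℝ} (hV : IsStarRicciSoliton S V lam) :
    lam = 0 := by
  let A := riemannianLieRinehart S.g
  let K := hS.data
  let W : SmoothField (𝓡 (2 * n + 1)) M := ⟨V, hV.smooth_V⟩
  let r (X Y : SmoothField (𝓡 (2 * n + 1)) M) : SmoothFunction (𝓡 (2 * n + 1)) M :=
    2 * constFunction lam * A.g X Y - A.lie W A.g X Y
  have hr (X Y : SmoothField (𝓡 (2 * n + 1)) M) (x : M) :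
      r X Y x = 2 * starRicci S.g S.f x (X x) (Y x) := by
    have h := hV.equation X Y X.contMDiff Y.contMDiff x
    change evalAt x (r X Y) = _
    simp only [r, map_sub, map_mul, map_ofNat]
    change 2 * lam * S.g.inner x (X x) (Y x) - lieDerivMetric S.g V X Y x = _
    linarith
  have htr {ι : Type} [Fintype ι] [DecidableEq ι]
      (F : RiemannianLieRinehart.CutoffFrame (SmoothFunction (𝓡 (2 * n + 1)) M)
        (SmoothField (𝓡 (2 * n + 1)) M) ι)
      (hF : ∀ (y : M) (T : TangentSpace (𝓡 (2 * n + 1)) y →ₗ[ℝ] TangentSpace (𝓡 (2 * n + 1)) y)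
        (Φ : SmoothField (𝓡 (2 * n + 1)) M → SmoothField (𝓡 (2 * n + 1)) M),
        (∀ Z, Φ Z y = T (Z y)) →
        F.tr Φ y = F.φ y * LinearMap.trace ℝ (TangentSpace (𝓡 (2 * n + 1)) y) T)
      (X Y : SmoothField (𝓡 (2 * n + 1)) M) : F.φ * r X Y = F.tr (K.starOp X Y) := by
    ext y
    obtain ⟨T, h1, h2⟩ := trace_starOp hS X Y y
    rw [hF y T _ h1, ← h2, ← hr]
    rfl
  have hlie (X Y) : A.lie K.ξ r X Y = -(4 * K.b ^ 3) * K.ff X Y := by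
    ext x
    obtain ⟨F, h1, -, hF⟩ := exists_cutoffFrame (I := 𝓡 (2 * n + 1)) x
    have h := congrArg (evalAt x) (K.lie_trace F r (htr F hF) X Y)
    rw [← evalAt_apply, ← evalAt_apply]
    simp only [map_add, map_neg, map_mul, map_ofNat, map_pow, map_zero] at h ⊢
    change F.φ x * F.φ x * (A.lie K.ξ r X Y x + 4 * β ^ 3 * K.ff X Y x) = 0 at h
    change A.lie K.ξ r X Y x = -(4 * β ^ 3) * K.ff X Y x
    rw [h1] at h
    linarith
  have hrξ (X) : r X K.ξ = 0 := by
    ext x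
    obtain ⟨F, h1, -, hF⟩ := exists_cutoffFrame (I := 𝓡 (2 * n + 1)) x
    have h := DFunLike.congr_fun (htr F hF X K.ξ) x
    have h2 (Z) : K.starOp X K.ξ Z = 0 := by
      rw [K.starOp_apply, K.f_ξ]
      simpa using A.curv_smul_middle X 0 0 (K.f Z)
    have h3 : F.tr (K.starOp X K.ξ) = 0 := by
      simp [RiemannianLieRinehart.CutoffFrame.tr, h2]
    rw [h3] at h
    change F.φ x * r X K.ξ x = 0 at h
    rwa [h1, one_mul] at h
  have hfin := K.soliton_condition W r (constFunction lam) (fieldDeriv_constFunction lam) hlie hrξ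
    (fun X Y => by simp only [r]; ring)
  obtain ⟨x⟩ := ‹Nonempty M›
  obtain ⟨v, hv, hv0⟩ : ∃ v : TangentSpace (𝓡 (2 * n + 1)) x, S.η x v = 0 ∧ v ≠ 0 := by
    have : FiniteDimensional ℝ (TangentSpace (𝓡 (2 * n + 1)) x) :=
      inferInstanceAs (FiniteDimensional ℝ (EuclideanSpace ℝ (Fin (2 * n + 1))))
    have hd : Module.finrank ℝ (TangentSpace (𝓡 (2 * n + 1)) x) = 2 * n + 1 :=
      finrank_euclideanSpace_fin
    have hk := LinearMap.ker_ne_bot_of_finrank_lt (f := (S.η x).toLinearMap)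
      (by rw [hd, Module.finrank_self]; omega)
    obtain ⟨v, h1, h2⟩ := Submodule.exists_mem_ne_zero_of_ne_bot hk
    exact ⟨v, h1, h2⟩
  obtain ⟨X, rfl⟩ := exists_field_apply_eq (I := 𝓡 (2 * n + 1)) x v
  have h := congrArg (evalAt x) (hfin X X)
  simp only [map_mul, map_ofNat, map_pow, map_zero] at h
  change 4 * β ^ 2 * lam * (S.g.inner x (X x) (X x)
    - S.g.inner x (S.ξ x) (X x) * S.g.inner x (S.ξ x) (X x)) = 0 at h
  rw [S.inner_ξ, hv, mul_zero, sub_zero] at h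
  have hg := S.g.pos x _ hv0
  have hβ := hS.ne_zero
  simpa [hg.ne', hβ] using h

end Structures

end WeakKenmotsu

end

theorem mainTheorem7 (n : ℕ) (hn : 1 ≤ n)
    (M : Type*) [TopologicalSpace M] [T2Space M] [Nonempty M]
    [ChartedSpace (EuclideanSpace ℝ (Fin (2 * n + 1))) M]
    [IsManifold (𝓡 (2 * n + 1)) ∞ M]
    (S : WeakKenmotsu.WeakAlmostContactMetric n M) (β : ℝ)
    (hS : WeakKenmotsu.IsWeakKenmotsu S β)
    (V : Π x : M, TangentSpace (𝓡 (2 * n + 1)) x) (lam : ℝ)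
    (hV : WeakKenmotsu.IsStarRicciSoliton S V lam) :
    lam = 0 :=
  hV.eq_zero hn hS
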